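/- Setting. Let $n,m\ge 1$. For integers $K,L\ge 1$ and label vectors $c\in[K]^n$, $z\in[L]^m$, write $M^{(k,l)}(c,z)$ for the submatrix of $M\in\mathbb R^{n\times m}$ with rows $\{i: c_i=k\}$ and columns $\{j: z_j=l\}$. For a matrix $M$ let $\Pi_1\{M\}=\sigma_1 uv^{T}$, where $\sigma_1$ is the largest singular value of $M$ and $u,v$ are corresponding unit singular vectors (any choice of them; empty blocks contribute nothing). Two-way node popularity model. There are $K_*,L_*\ge1$, $c_*\in[K_*]^n$, $z_*\in[L_*]^m$ and real matrices $\Lambda\in\mathbb R^{n\times L_*}$, $\widetilde\Lambda\in\mathbb R^{m\times K_*}$ such that the entries $A_{ij}$ of the random $n\times m$ matrix $A$ are mutually independent, with $\mathbb E A_{ij}=(P_*)_{ij}=\Lambda_{i,(z_*)_j}\widetilde\Lambda_{j,(c_*)_i}$ and $\mathbb E\exp(s(A_{ij}-\mathbb EA_{ij}))\le\exp(\sigma_{ij}^2s^2/2)$ for all $s\in\mathbb R$. Put $\sigma_{\max}^2=\max_{i,j}\sigma_{ij}^2$, and let $\tilde\sigma_{\max}^2\ge\sigma_{\max}^2$ be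 a number fixed in advance. Penalty. For $C,\alpha_1,\alpha_2>0$ let $$F_2(n,m,K,L)=n\log K+\log n+m\log L+\log m,$$ $$F_1(n,m,K,L)=C\{nL+mK+KL\log(2KL)+KL(n\log K+\log n+m\log L+\log m)\},$$ $$\mathrm{Pen}(n,m,K,L)=2\tilde\sigma_{\max}^2\{(1+1/\alpha_2)F_1(n,m,K,L)+(1/\alpha_1)F_2(n,m,K,L)\}.$$ Estimator. Let $(\widehat K,\widehat L,\hat c,\hat z)$ minimize $$\sum_{k=1}^{K}\sum_{l=1}^{L}\big\|A^{(k,l)}(c,z)-\Pi_1\{A^{(k,l)}(c,z)\}\big\|_F^2+\mathrm{Pen}(n,m,K,L)$$ over all $K,L\ge1$, $c\in[K]^n$, $z\in[L]^m$, and let $\widehat P$ be the $n\times m$ matrix with blocks $\widehat P^{(k,l)}(\hat c,\hat z)=\Pi_1\{A^{(k,l)}(\hat c,\hat z)\}$ (chosen measurably). Theorem 2. There is an absolute constant $C>0$ such that, for all $\alpha_1,\alpha_2>0$ with $\alpha_1+4\alpha_2<1$, with $$H_1=\frac{1}{1-\alpha_1-4\alpha_2},\qquad H_2=\frac{2C+2/\alpha_1+2C/\alpha_2}{1-\alpha_1-4\alpha_2},$$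 the following holds for all $n,m\ge1$ and every model and estimator as above. One has $$\|\widehat P-P_*\|_F^2=\sum_{k=1}^{\widehat K}\sum_{l=1}^{\widehat L}\big\|\Pi_1\{A^{(k,l)}(\hat c,\hat z)\}-P_*^{(k,l)}(\hat c,\hat z)\big\|_F^2,$$ for every $t\ge0$ $$\mathbb P\Big\{\frac1{nm}\|\widehat P-P_*\|_F^2\le\frac{H_1}{nm}\mathrm{Pen}(n,m,K_*,L_*)+\frac{H_2\sigma_{\max}^2}{nm}\,t\Big\}\ge1-3e^{-t},$$ and $\|\widehat P-P_*\|_F^2$ is integrable with $$\frac1{nm}\mathbb E\|\widehat P-P_*\|_F^2\le\frac{H_1}{nm}\mathrm{Pen}(n,m,K_*,L_*)+\frac{3H_2\sigma_{\max}^2}{nm}.$$ Consequently the estimator is consistent: along any sequence of such models and estimators with common $\tilde\sigma_{\max}^2$, $\alpha_1$, $\alpha_2$, in which $n\wedge m\to\infty$ and $K_*L_*\log(K_*L_*)/(n\wedge m)\to0$, one has $\mathrm{Pen}(n,m,K_*,L_*)/(nm)\to0$, $\frac1{nm}\mathbb E\|\widehat P-P_*\|_F^2\to0$, and $\frac1{nm}\|\widehat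 P-P_*\|_F^2\to0$ in probability. -/

import Mathlib

open MeasureTheory ProbabilityTheory Filter Topology
open scoped NNReal

universe u

noncomputable section

namespace TNPM

/-- A two-way community assignment of the row nodes `Fin n` and the column nodes `Fin m`:
numbers `K`, `L` of out- and in-communities and label vectors `c ∈ [K]^n`, `z ∈ [L]^m`. -/
structure CoClustering (n m : ℕ) where
  K : ℕ
  L : ℕ
  c : Fin n → Fin K
  z : Fin m → Fin L

/-- The `(k,l)`-th block `M^{(k,l)}(c,z)`: rows with label `k`, columns with label `l`. -/
def block {n m : ℕ} (G : CoClustering n m) (M : Matrix (Fin n) (Fin m) ℝ)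
    (k : Fin G.K) (l : Fin G.L) : Matrix {i // G.c i = k} {j // G.z j = l} ℝ :=
  M.submatrix Subtype.val Subtype.val

/-- The squared Frobenius norm. -/
def frobSq {ι κ : Type} [Fintype ι] [Fintype κ] (M : Matrix ι κ ℝ) : ℝ :=
  ∑ i, ∑ j, M i j ^ 2

/-- `s` is a singular value of `M` with unit left and right singular vectors `x` and `y`. -/
structure IsSingularTriple {ι κ : Type} [Fintype ι] [Fintype κ] (M : Matrix ι κ ℝ)
    (s : ℝ) (x : ι → ℝ) (y : κ → ℝ) : Prop where
  nonneg : 0 ≤ s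
  left_unit : x ⬝ᵥ x = 1
  right_unit : y ⬝ᵥ y = 1
  mulVec_right : M.mulVec y = s • x
  mulVec_left : M.transpose.mulVec x = s • y

/-- `B` is a rank-one projection `Π₁(M) = σ₁ x yᵀ` of `M`, where `σ₁` is the largest singular
value of `M` and `x`, `y` are corresponding singular vectors (any choice of them, if `σ₁` is a
multiple singular value). A block without rows or without columns has no entries, and its
projection is the empty matrix. -/
def IsRankOneProjection {ι κ : Type} [Fintype ι] [Fintype κ] (M B : Matrix ι κ ℝ) : Prop :=
  (IsEmpty ι ∨ IsEmpty κ) ∨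
    ∃ (s : ℝ) (x : ι → ℝ) (y : κ → ℝ), IsSingularTriple M s x y ∧
      (∀ (s' : ℝ) (x' : ι → ℝ) (y' : κ → ℝ), IsSingularTriple M s' x' y' → s' ≤ s) ∧
      B = s • Matrix.vecMulVec x y

/-- Every block of `B` is a rank-one projection of the corresponding block of `A`. -/
def IsBlockProjection {n m : ℕ} (A : Matrix (Fin n) (Fin m) ℝ) (G : CoClustering n m)
    (B : Matrix (Fin n) (Fin m) ℝ) : Prop :=
  ∀ k l, IsRankOneProjection (block G A k l) (block G B k l)

/-- `F₂(n,m,K,L) = n log K + log n + m log L + log m`. -/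
def F₂ (n m K L : ℕ) : ℝ :=
  n * Real.log K + Real.log n + m * Real.log L + Real.log m

/-- `F₁(n,m,K,L) = C {nL + mK + KL log(2KL) + KL (n log K + log n + m log L + log m)}`. -/
def F₁ (C : ℝ) (n m K L : ℕ) : ℝ :=
  C * (n * L + m * K + K * L * Real.log (2 * K * L)
    + K * L * (n * Real.log K + Real.log n + m * Real.log L + Real.log m))

/-- The penalty; the argument `τ` is the upper bound `σ̃²_max` for the variance proxies. -/
def Pen (C α₁ α₂ τ : ℝ) (n m K L : ℕ) : ℝ :=
  2 * τ * ((1 + 1 / α₂) * F₁ C n m K L + 1 / α₁ * F₂ n m K L)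

/-- The penalized block rank-one residual of `A` at the assignment `G`, the blocks of `B` being
the rank-one projections of the blocks of `A`. -/
def objective {n m : ℕ} (pen : ℕ → ℕ → ℝ) (A : Matrix (Fin n) (Fin m) ℝ)
    (G : CoClustering n m) (B : Matrix (Fin n) (Fin m) ℝ) : ℝ :=
  ∑ k, ∑ l, frobSq (block G A k l - block G B k l) + pen G.K G.L

/-- `G = (K̂, L̂, ĉ, ẑ)` minimizes the penalized residual of `A` over all `(K, L, c, z)`, and the
matrix `B = P̂` is made of the rank-one projections of the blocks of `A` under `G`. -/
def IsPenalizedEstimate {n m : ℕ} (pen : ℕ → ℕ → ℝ) (A : Matrix (Fin n) (Fin m) ℝ)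
    (G : CoClustering n m) (B : Matrix (Fin n) (Fin m) ℝ) : Prop :=
  IsBlockProjection A G B ∧
    ∀ (G' : CoClustering n m) (B' : Matrix (Fin n) (Fin m) ℝ),
      IsBlockProjection A G' B' → objective pen A G B ≤ objective pen A G' B'

/-- The mean matrix of the two-way node popularity model, `P i j = Λ i (z j) * Λ' j (c i)`. -/
def meanMatrix {n m : ℕ} (G : CoClustering n m) (Λ : Matrix (Fin n) (Fin G.L) ℝ)
    (Λ' : Matrix (Fin m) (Fin G.K) ℝ) : Matrix (Fin n) (Fin m) ℝ :=
  Matrix.of fun i j => Λ i (G.z j) * Λ' j (G.c i)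

/-- The random matrix `A` follows the two-way node popularity model with communities `G` and
popularity parameters `Λ`, `Λ'`: the entries are independent with the means `meanMatrix G Λ Λ'`,
and `A i j - 𝔼 (A i j)` is sub-Gaussian with variance proxy `v i j`. -/
structure IsModel {n m : ℕ} {Ω : Type u} [MeasurableSpace Ω] (μ : Measure Ω)
    (A : Ω → Matrix (Fin n) (Fin m) ℝ) (G : CoClustering n m)
    (Λ : Matrix (Fin n) (Fin G.L) ℝ) (Λ' : Matrix (Fin m) (Fin G.K) ℝ)
    (v : Fin n → Fin m → ℝ≥0) : Prop where
  measurable : ∀ i j, Measurable fun ω => A ω i j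
  indep : iIndepFun (fun (p : Fin n × Fin m) ω => A ω p.1 p.2) μ
  mean : ∀ i j, ∫ ω, A ω i j ∂μ = meanMatrix G Λ Λ' i j
  subG : ∀ i j, HasSubgaussianMGF (fun ω => A ω i j - ∫ ω', A ω' i j ∂μ) (v i j) μ

/-- `σ²_max`, the largest variance proxy. -/
def sigmaMaxSq {n m : ℕ} (v : Fin n → Fin m → ℝ≥0) : ℝ≥0 :=
  Finset.univ.sup fun p : Fin n × Fin m => v p.1 p.2

/-- `H₁ = 1 / (1 - α₁ - 4 α₂)`. -/
def H₁ (α₁ α₂ : ℝ) : ℝ := 1 / (1 - α₁ - 4 * α₂)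

/-- `H₂ = (2 C + 2 / α₁ + 2 C / α₂) / (1 - α₁ - 4 α₂)`. -/
def H₂ (C α₁ α₂ : ℝ) : ℝ := (2 * C + 2 / α₁ + 2 * C / α₂) / (1 - α₁ - 4 * α₂)

end TNPM

end

/-!
Write `ξ = A - P_*` and `D = P̂ - P_*`. By the Eckart–Young theorem the blocks of `P_*` under the
true assignment, which have rank at most one, are no better approximations of `A` than their
rank-one projections, so minimality of the estimate gives the basic inequality
`‖D‖² ≤ 2⟨ξ, D⟩ + Pen(K_*, L_*) - Pen(K̂, L̂)`.

A matrix has blocks of rank at most one under `G` if and only if it is of the form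
`meanMatrix G a b`; let `W` be the best approximation of `P_*` of this form under the *estimated*
assignment. Then `D = (P̂ - W) + (W - P_*)`. The direction of `W - P_*` depends on the assignment
only, which makes `⟨ξ, W - P_*⟩` a sub-Gaussian variable for each assignment. The blocks of `P̂ - W`
have rank at most two, `‖P̂ - W‖ ≤ 2 ‖D‖`, and orthogonalizing in each block writes `P̂ - W` as an
orthogonal sum of two matrices `meanMatrix G a b` (`exists_orthogonal_meanMatrix`). This is the
deterministic oracle inequality `frobSq_sub_mul_le`.

The noise on all matrices `meanMatrix G a b` is controlled by its values on finitely many of them.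
Such a matrix is bilinear in a left factor, with the Euclidean norm on `ℝ^{nL}`, and a right factor,
with the largest of the Euclidean norms of its blocks on `ℝ^{mK}`; products of `1/2`-nets of the two
unit balls cost a factor `4` and have at most `5^{nL + mK}` points
(`exists_finset_meanMatrix_net`). This exponent is what the terms `nL + mK` of the penalty pay for,
and `F₂` pays for the union bound over the assignments (`exp_neg_F₂`, `sum_exp_neg_F₂`). Only
assignments with at most `n` and `m` labels need to be considered: unused labels can be dropped, and
this does not increase the penalty.

The tail bound `IsModel.measureReal_lt_frobSq_le` then holds with `C = 64`, it integrates to the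
bound on the mean, and the consistency follows since the penalty is of order
`(n + m) K L (1 + log (K L))`.
-/

noncomputable section

namespace TNPM

/-! ### The best rank-one approximation of a matrix -/

section RankOne

variable {ι κ : Type} [Fintype ι] [Fintype κ]

/-- The Frobenius inner product. -/
def frobInner (M N : Matrix ι κ ℝ) : ℝ := ∑ i, ∑ j, M i j * N i j

lemma frobSq_nonneg (M : Matrix ι κ ℝ) : 0 ≤ frobSq M :=
  Finset.sum_nonneg fun _ _ => Finset.sum_nonneg fun _ _ => sq_nonneg _

lemma frobInner_add_right (M N N' : Matrix ι κ ℝ) :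
    frobInner M (N + N') = frobInner M N + frobInner M N' := by
  simp only [frobInner, Matrix.add_apply, mul_add, Finset.sum_add_distrib]

lemma frobInner_smul_right (r : ℝ) (M N : Matrix ι κ ℝ) :
    frobInner M (r • N) = r * frobInner M N := by
  simp only [frobInner, Matrix.smul_apply, smul_eq_mul, Finset.mul_sum]
  exact Finset.sum_congr rfl fun _ _ => Finset.sum_congr rfl fun _ _ => by ring

lemma frobSq_sub (M N : Matrix ι κ ℝ) :
    frobSq (M - N) = frobSq M - 2 * frobInner M N + frobSq N := by
  simp only [frobSq, frobInner, Matrix.sub_apply, Finset.mul_sum, ← Finset.sum_sub_distrib,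
    ← Finset.sum_add_distrib]
  exact Finset.sum_congr rfl fun _ _ => Finset.sum_congr rfl fun _ _ => by ring

lemma frobSq_smul (r : ℝ) (M : Matrix ι κ ℝ) : frobSq (r • M) = r ^ 2 * frobSq M := by
  simp only [frobSq, Matrix.smul_apply, smul_eq_mul, Finset.mul_sum, mul_pow]

lemma frobInner_sq_le (M N : Matrix ι κ ℝ) :
    frobInner M N ^ 2 ≤ frobSq M * frobSq N := by
  simp only [frobInner, frobSq, ← Fintype.sum_prod_type']
  exact Finset.sum_mul_sq_le_sq_mul_sq _ _ _

lemma frobInner_vecMulVec (M : Matrix ι κ ℝ) (a : ι → ℝ) (b : κ → ℝ) :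
    frobInner M (Matrix.vecMulVec a b) = a ⬝ᵥ M.mulVec b := by
  simp only [frobInner, Matrix.vecMulVec_apply, dotProduct, Matrix.mulVec, Finset.mul_sum]
  exact Finset.sum_congr rfl fun _ _ => Finset.sum_congr rfl fun _ _ => by ring

lemma frobSq_vecMulVec (a : ι → ℝ) (b : κ → ℝ) :
    frobSq (Matrix.vecMulVec a b) = (a ⬝ᵥ a) * (b ⬝ᵥ b) := by
  simp only [frobSq, Matrix.vecMulVec_apply, dotProduct, Finset.sum_mul_sum]
  exact Finset.sum_congr rfl fun _ _ => Finset.sum_congr rfl fun _ _ => by ring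

lemma zero_le_dotProduct_self (a : ι → ℝ) : 0 ≤ a ⬝ᵥ a :=
  Finset.sum_nonneg fun _ _ => mul_self_nonneg _

lemma dotProduct_sq_le (a b : ι → ℝ) : (a ⬝ᵥ b) ^ 2 ≤ (a ⬝ᵥ a) * (b ⬝ᵥ b) := by
  have := Finset.sum_mul_sq_le_sq_mul_sq Finset.univ a b
  simpa only [dotProduct, ← pow_two] using this

lemma isCompact_dotProduct_self_eq_one : IsCompact {y : κ → ℝ | y ⬝ᵥ y = 1} := by
  have hc : IsClosed {y : κ → ℝ | y ⬝ᵥ y = 1} :=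
    isClosed_eq (by unfold dotProduct; fun_prop) continuous_const
  refine (isCompact_univ_pi fun _ : κ => isCompact_Icc (a := (-1 : ℝ)) (b := 1)).of_isClosed_subset
    hc fun y hy j _ => ?_
  have h1 : y j * y j ≤ 1 := by
    have hy' : ∑ j, y j * y j = 1 := hy
    rw [← hy']
    exact Finset.single_le_sum (f := fun j => y j * y j) (fun _ _ => mul_self_nonneg _)
      (Finset.mem_univ j)
  exact abs_le.1 (abs_le_one_iff_mul_self_le_one.2 h1)

/-- A top singular triple: `y` maximizes `‖M y‖` on the unit sphere, and the first-order condition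
at the maximum is the eigenvalue equation `Mᵀ M y = s² y`. -/
theorem exists_isSingularTriple_bound [Nonempty ι] [Nonempty κ] (M : Matrix ι κ ℝ) :
    ∃ (s : ℝ) (x : ι → ℝ) (y : κ → ℝ), IsSingularTriple M s x y ∧
      ∀ w, M.mulVec w ⬝ᵥ M.mulVec w ≤ s ^ 2 * (w ⬝ᵥ w) := by
  classical
  obtain ⟨y, hy, hmax⟩ := isCompact_dotProduct_self_eq_one.exists_isMaxOn
    (⟨Pi.single (Classical.arbitrary κ) 1, by simp⟩ : {y : κ → ℝ | y ⬝ᵥ y = 1}.Nonempty)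
    (f := fun y => M.mulVec y ⬝ᵥ M.mulVec y)
    (Continuous.continuousOn (by unfold dotProduct Matrix.mulVec dotProduct; fun_prop))
  have hy : y ⬝ᵥ y = 1 := hy
  set q : ℝ := M.mulVec y ⬝ᵥ M.mulVec y with hq
  have hq0 : 0 ≤ q := zero_le_dotProduct_self _
  have hbound : ∀ w, M.mulVec w ⬝ᵥ M.mulVec w ≤ q * (w ⬝ᵥ w) := by
    intro w
    rcases eq_or_ne w 0 with rfl | hw
    · simp
    have hpos : 0 < w ⬝ᵥ w :=
      lt_of_le_of_ne (zero_le_dotProduct_self w) fun h => hw (dotProduct_self_eq_zero.1 h.symm)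
    set r := Real.sqrt (w ⬝ᵥ w) with hr
    have hr0 : 0 < r := Real.sqrt_pos.2 hpos
    have hrr : r * r = w ⬝ᵥ w := Real.mul_self_sqrt hpos.le
    have hmem : (r⁻¹ • w) ⬝ᵥ (r⁻¹ • w) = 1 := by
      rw [smul_dotProduct, dotProduct_smul, ← hrr]
      simp only [smul_eq_mul]
      field_simp
    have h := hmax (show r⁻¹ • w ∈ {y : κ → ℝ | y ⬝ᵥ y = 1} from hmem)
    simp only [Set.mem_ofPred_eq, Matrix.mulVec_smul, smul_dotProduct, dotProduct_smul,
      smul_eq_mul] at h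
    have h' : M.mulVec w ⬝ᵥ M.mulVec w = (r * r) * (r⁻¹ * (r⁻¹ * (M.mulVec w ⬝ᵥ M.mulVec w))) := by
      field_simp
    rw [h', ← hrr, mul_comm q]
    exact mul_le_mul_of_nonneg_left h (mul_self_nonneg r)
  have hcrit : ∀ w, M.mulVec y ⬝ᵥ M.mulVec w = q * (y ⬝ᵥ w) := by
    intro w
    -- the quadratic form `ε ↦ 2 ε b + ε² d` is nonnegative, hence `b = 0`
    have hε : ∀ ε : ℝ, 0 ≤ 2 * ε * (q * (y ⬝ᵥ w) - M.mulVec y ⬝ᵥ M.mulVec w)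
        + ε ^ 2 * (q * (w ⬝ᵥ w) - M.mulVec w ⬝ᵥ M.mulVec w) := by
      intro ε
      have h := hbound (y + ε • w)
      simp only [Matrix.mulVec_add, Matrix.mulVec_smul, add_dotProduct, dotProduct_add,
        smul_dotProduct, dotProduct_smul, smul_eq_mul, hy] at h
      rw [dotProduct_comm w y, dotProduct_comm (M.mulVec w) (M.mulVec y), ← hq] at h
      linarith
    set b := q * (y ⬝ᵥ w) - M.mulVec y ⬝ᵥ M.mulVec w
    set d := q * (w ⬝ᵥ w) - M.mulVec w ⬝ᵥ M.mulVec w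
    have hd : 0 ≤ d := sub_nonneg.2 (hbound w)
    have h := hε (-b / (d + 1))
    have hd1 : 0 < d + 1 := by linarith
    have h2 : 2 * (-b / (d + 1)) * b + (-b / (d + 1)) ^ 2 * d
        = -(b ^ 2 * (d + 2)) / (d + 1) ^ 2 := by
      field_simp; ring
    rw [h2, le_div_iff₀ (by positivity)] at h
    have : b ^ 2 = 0 := by nlinarith [sq_nonneg b]
    have : b = 0 := by simpa using this
    linarith
  have hMM : M.transpose.mulVec (M.mulVec y) = q • y := by
    refine dotProduct_eq _ _ fun w => ?_
    rw [Matrix.mulVec_transpose, ← Matrix.dotProduct_mulVec, hcrit w, smul_dotProduct, smul_eq_mul]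
  rcases hq0.eq_or_lt with hq00 | hqpos
  · have hM : M = 0 := by
      ext i j
      have h := hbound (Pi.single j 1)
      rw [← hq00, zero_mul] at h
      have h0 := dotProduct_self_eq_zero.1 (le_antisymm h (zero_le_dotProduct_self _))
      have := congrFun h0 i
      simpa using this
    refine ⟨0, Pi.single (Classical.arbitrary ι) 1, y, ⟨le_rfl, by simp, hy, ?_, ?_⟩, ?_⟩ <;>
      subst hM
    · simp
    · rw [Matrix.transpose_zero, Matrix.zero_mulVec, zero_smul]
    · simp
  · have hs : 0 < Real.sqrt q := Real.sqrt_pos.2 hqpos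
    have hss : Real.sqrt q * Real.sqrt q = q := Real.mul_self_sqrt hq0
    refine ⟨Real.sqrt q, (Real.sqrt q)⁻¹ • M.mulVec y, y, ⟨hs.le, ?_, hy, ?_, ?_⟩, ?_⟩
    · rw [smul_dotProduct, dotProduct_smul, ← hq, smul_eq_mul, smul_eq_mul]
      nth_rewrite 3 [← hss]
      field_simp
    · rw [smul_smul, mul_inv_cancel₀ hs.ne', one_smul]
    · rw [Matrix.mulVec_smul, hMM, smul_smul]
      congr 1
      nth_rewrite 2 [← hss]
      field_simp
    · rw [Real.sq_sqrt hq0]; exact hbound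

lemma IsSingularTriple.le_of_bound {M : Matrix ι κ ℝ} {s s' : ℝ} {x : ι → ℝ} {y : κ → ℝ}
    (h : IsSingularTriple M s' x y) (hs : 0 ≤ s)
    (hb : ∀ w, M.mulVec w ⬝ᵥ M.mulVec w ≤ s ^ 2 * (w ⬝ᵥ w)) : s' ≤ s := by
  have h1 := hb y
  rw [h.mulVec_right, smul_dotProduct, dotProduct_smul, h.left_unit, h.right_unit, smul_eq_mul,
    smul_eq_mul, mul_one, mul_one, ← pow_two] at h1
  exact (pow_le_pow_iff_left₀ h.nonneg hs two_ne_zero).1 h1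

theorem exists_isRankOneProjection (M : Matrix ι κ ℝ) : ∃ B, IsRankOneProjection M B := by
  by_cases hι : IsEmpty ι
  · exact ⟨0, Or.inl (Or.inl hι)⟩
  by_cases hκ : IsEmpty κ
  · exact ⟨0, Or.inl (Or.inr hκ)⟩
  rw [not_isEmpty_iff] at hι hκ
  obtain ⟨s, x, y, h, hb⟩ := exists_isSingularTriple_bound M
  exact ⟨s • Matrix.vecMulVec x y,
    Or.inr ⟨s, x, y, h, fun s' x' y' h' => h'.le_of_bound h.nonneg hb, rfl⟩⟩

lemma IsRankOneProjection.exists_eq_vecMulVec {M B : Matrix ι κ ℝ}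
    (h : IsRankOneProjection M B) : ∃ a b, B = Matrix.vecMulVec a b := by
  rcases h with (h | h) | ⟨s, x, y, -, -, rfl⟩
  · exact ⟨0, 0, by ext i; exact h.elim i⟩
  · exact ⟨0, 0, by ext i j; exact h.elim j⟩
  · exact ⟨s • x, y, by rw [Matrix.smul_vecMulVec]⟩

/-- The Eckart–Young theorem in rank one. -/
theorem IsRankOneProjection.frobSq_sub_le {M B : Matrix ι κ ℝ} (h : IsRankOneProjection M B)
    (a : ι → ℝ) (b : κ → ℝ) : frobSq (M - B) ≤ frobSq (M - Matrix.vecMulVec a b) := by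
  rcases h with (h | h) | ⟨s, x, y, ht, hmax, rfl⟩
  · simp [frobSq]
  · simp [frobSq]
  have hι : Nonempty ι := by
    by_contra hc
    rw [not_nonempty_iff] at hc
    simpa using ht.left_unit
  have hκ : Nonempty κ := by
    by_contra hc
    rw [not_nonempty_iff] at hc
    simpa using ht.right_unit
  obtain ⟨s', x', y', ht', hb⟩ := exists_isSingularTriple_bound M
  have hss : s' ^ 2 ≤ s ^ 2 := pow_le_pow_left₀ ht'.nonneg (hmax _ _ _ ht') 2
  rw [frobSq_sub, frobSq_sub, frobInner_smul_right, frobSq_smul, frobInner_vecMulVec,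
    frobSq_vecMulVec, frobInner_vecMulVec, frobSq_vecMulVec, ht.mulVec_right, dotProduct_smul,
    ht.left_unit, ht.right_unit, smul_eq_mul]
  have ha := zero_le_dotProduct_self a
  have hbb := zero_le_dotProduct_self b
  set r := a ⬝ᵥ M.mulVec b
  have h1 : r ^ 2 ≤ s ^ 2 * ((a ⬝ᵥ a) * (b ⬝ᵥ b)) :=
    calc r ^ 2 ≤ (a ⬝ᵥ a) * (M.mulVec b ⬝ᵥ M.mulVec b) := dotProduct_sq_le _ _
      _ ≤ (a ⬝ᵥ a) * (s ^ 2 * (b ⬝ᵥ b)) := by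
          refine mul_le_mul_of_nonneg_left ((hb b).trans ?_) ha
          exact mul_le_mul_of_nonneg_right hss hbb
      _ = _ := by ring
  have h2 : 2 * r ≤ s ^ 2 + (a ⬝ᵥ a) * (b ⬝ᵥ b) := by
    refine le_of_abs_le (abs_le_of_sq_le_sq ?_ (by positivity))
    nlinarith [sq_nonneg (s ^ 2 - (a ⬝ᵥ a) * (b ⬝ᵥ b))]
  linarith

end RankOne

/-! ### Blockwise rank-one matrices

A matrix has blocks of rank at most one under the assignment `G` exactly when it has the form
`meanMatrix G a b`. -/

section Blocks

variable {n m : ℕ}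

lemma sum_fiberwise_subtype {ι κ : Type} [Fintype ι] [Fintype κ] [DecidableEq κ] (c : ι → κ)
    (f : ι → ℝ) : ∑ k, ∑ i : {i // c i = k}, f i = ∑ i, f i := by
  rw [← Fintype.sum_sigma' (fun k (i : {i // c i = k}) => f i)]
  exact Fintype.sum_equiv (Equiv.sigmaFiberEquiv c) _ _ fun _ => rfl

lemma sum_frobSq_block (G : CoClustering n m) (M : Matrix (Fin n) (Fin m) ℝ) :
    ∑ k, ∑ l, frobSq (block G M k l) = frobSq M := by
  simp only [frobSq, block, Matrix.submatrix_apply]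
  have h : ∀ k, ∑ l, ∑ i : {i // G.c i = k}, ∑ j : {j // G.z j = l}, M i j ^ 2
      = ∑ i : {i // G.c i = k}, ∑ j, M i j ^ 2 := by
    intro k
    rw [Finset.sum_comm]
    exact Finset.sum_congr rfl fun i _ => sum_fiberwise_subtype G.z fun j => M i j ^ 2
  simp only [h]
  exact sum_fiberwise_subtype G.c fun i => ∑ j, M i j ^ 2

lemma block_sub (G : CoClustering n m) (M N : Matrix (Fin n) (Fin m) ℝ) (k : Fin G.K)
    (l : Fin G.L) : block G (M - N) k l = block G M k l - block G N k l := rfl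

lemma objective_eq (pen : ℕ → ℕ → ℝ) (A : Matrix (Fin n) (Fin m) ℝ) (G : CoClustering n m)
    (B : Matrix (Fin n) (Fin m) ℝ) :
    objective pen A G B = frobSq (A - B) + pen G.K G.L := by
  simp only [objective, ← block_sub, sum_frobSq_block]

lemma block_meanMatrix (G : CoClustering n m) (a : Matrix (Fin n) (Fin G.L) ℝ)
    (b : Matrix (Fin m) (Fin G.K) ℝ) (k : Fin G.K) (l : Fin G.L) :
    block G (meanMatrix G a b) k l = Matrix.vecMulVec (fun i => a i.1 l) (fun j => b j.1 k) := by
  ext ⟨i, hi⟩ ⟨j, hj⟩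
  subst hi hj
  rfl

theorem exists_isBlockProjection (A : Matrix (Fin n) (Fin m) ℝ) (G : CoClustering n m) :
    ∃ B, IsBlockProjection A G B := by
  choose B hB using fun k l => exists_isRankOneProjection (block G A k l)
  refine ⟨Matrix.of fun i j => B (G.c i) (G.z j) ⟨i, rfl⟩ ⟨j, rfl⟩, fun k l => ?_⟩
  convert hB k l using 1
  ext ⟨i, hi⟩ ⟨j, hj⟩
  subst hi hj
  rfl

lemma IsBlockProjection.exists_eq_meanMatrix {A B : Matrix (Fin n) (Fin m) ℝ}
    {G : CoClustering n m} (h : IsBlockProjection A G B) : ∃ a b, B = meanMatrix G a b := by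
  choose a b hab using fun k l => (h k l).exists_eq_vecMulVec
  refine ⟨fun i l => a (G.c i) l ⟨i, rfl⟩, fun j k => b k (G.z j) ⟨j, rfl⟩, ?_⟩
  ext i j
  exact congrFun (congrFun (hab (G.c i) (G.z j)) ⟨i, rfl⟩) ⟨j, rfl⟩

lemma IsBlockProjection.frobSq_sub_le {A B : Matrix (Fin n) (Fin m) ℝ}
    {G : CoClustering n m} (h : IsBlockProjection A G B) (a : Matrix (Fin n) (Fin G.L) ℝ)
    (b : Matrix (Fin m) (Fin G.K) ℝ) :
    frobSq (A - B) ≤ frobSq (A - meanMatrix G a b) := by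
  rw [← sum_frobSq_block G, ← sum_frobSq_block G]
  refine Finset.sum_le_sum fun k _ => Finset.sum_le_sum fun l _ => ?_
  rw [block_sub, block_sub, block_meanMatrix]
  exact (h k l).frobSq_sub_le _ _

lemma exists_surjective_factor {n K : ℕ} (c : Fin n → Fin K) :
    ∃ (K' : ℕ) (c' : Fin n → Fin K') (f : Fin K' → Fin K), K' ≤ n ∧ K' ≤ K ∧
      ∀ i, c i = f (c' i) := by
  classical
  let e := Fintype.equivFin (Set.range c)
  refine ⟨Fintype.card (Set.range c), fun i => e ⟨c i, i, rfl⟩, fun k => (e.symm k).1, ?_, ?_, ?_⟩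
  · simpa using Fintype.card_range_le c
  · exact (Fintype.card_subtype_le (· ∈ Set.range c)).trans_eq (Fintype.card_fin K)
  · simp

/-- Unused labels can be dropped: a blockwise rank-one matrix stays so under an assignment with
at most `n` and `m` labels, which does not have more labels than the given one. -/
theorem exists_meanMatrix_eq_of_le (G : CoClustering n m) (a : Matrix (Fin n) (Fin G.L) ℝ)
    (b : Matrix (Fin m) (Fin G.K) ℝ) :
    ∃ (G' : CoClustering n m) (a' : Matrix (Fin n) (Fin G'.L) ℝ)
      (b' : Matrix (Fin m) (Fin G'.K) ℝ), G'.K ≤ n ∧ G'.L ≤ m ∧ G'.K ≤ G.K ∧ G'.L ≤ G.L ∧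
        meanMatrix G a b = meanMatrix G' a' b' := by
  obtain ⟨K', c', f, hK, hK', hf⟩ := exists_surjective_factor G.c
  obtain ⟨L', z', g, hL, hL', hg⟩ := exists_surjective_factor G.z
  refine ⟨⟨K', L', c', z'⟩, fun i l => a i (g l), fun j k => b j (f k), hK, hL, hK', hL', ?_⟩
  ext i j
  simp only [meanMatrix, Matrix.of_apply, hf, hg]

end Blocks

/-! ### Nets of unit balls -/

section Nets

variable {E : Type*} [NormedAddCommGroup E] [NormedSpace ℝ E] [FiniteDimensional ℝ E]

/-- A maximal `1/2`-separated subset of the unit ball is a `1/2`-net, and the volume argument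
behind `Besicovitch.card_le_of_separated` bounds its size. -/
theorem exists_net_unitBall (E : Type*) [NormedAddCommGroup E] [NormedSpace ℝ E]
    [FiniteDimensional ℝ E] : ∃ N : Finset E, N.card ≤ 5 ^ Module.finrank ℝ E ∧
      (∀ y ∈ N, ‖y‖ ≤ 1) ∧ ∀ y : E, ‖y‖ ≤ 1 → ∃ y₀ ∈ N, ‖y - y₀‖ ≤ 1 / 2 := by
  classical
  let Sep : Finset E → Prop := fun N =>
    (∀ y ∈ N, ‖y‖ ≤ 1) ∧ ∀ c ∈ N, ∀ d ∈ N, c ≠ d → 1 / 2 ≤ ‖c - d‖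
  have hcard : ∀ N, Sep N → N.card ≤ 5 ^ Module.finrank ℝ E := by
    intro N hN
    have hinj : Function.Injective fun y : E => (2 : ℝ) • y := smul_right_injective E two_ne_zero
    rw [← Finset.card_image_of_injective N hinj]
    refine Besicovitch.card_le_of_separated _ ?_ ?_
    · simp only [Finset.mem_image]
      rintro _ ⟨y, hy, rfl⟩
      rw [norm_smul, Real.norm_two]
      linarith [hN.1 y hy]
    · simp only [Finset.mem_image]
      rintro _ ⟨y, hy, rfl⟩ _ ⟨w, hw, rfl⟩ hne
      rw [← smul_sub, norm_smul, Real.norm_two]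
      linarith [hN.2 y hy w hw fun h => hne (by rw [h])]
  let Q : ℕ → Prop := fun k => ∃ N, Sep N ∧ N.card = k
  have hQ0 : Q 0 := ⟨∅, ⟨by simp, by simp⟩, rfl⟩
  obtain ⟨N, hN, hNc⟩ : Q (Nat.findGreatest Q (5 ^ Module.finrank ℝ E)) :=
    Nat.findGreatest_spec (Nat.zero_le _) hQ0
  refine ⟨N, hcard N hN, hN.1, fun y hy => ?_⟩
  by_contra! hfar
  have hyN : y ∉ N := fun h => by
    have := hfar y h
    norm_num at this
  have hins : Sep (insert y N) := by
    refine ⟨fun w hw => ?_, fun c hc d hd hcd => ?_⟩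
    · rcases Finset.mem_insert.1 hw with rfl | hw
      · exact hy
      · exact hN.1 w hw
    · rcases Finset.mem_insert.1 hc with rfl | hc' <;> rcases Finset.mem_insert.1 hd with rfl | hd'
      · exact absurd rfl hcd
      · exact (hfar d hd').le
      · rw [norm_sub_rev]; exact (hfar c hc').le
      · exact hN.2 c hc' d hd' hcd
  have hle : (insert y N).card ≤ Nat.findGreatest Q (5 ^ Module.finrank ℝ E) :=
    Nat.le_findGreatest (hcard _ hins) ⟨_, hins, rfl⟩
  rw [Finset.card_insert_of_notMem hyN, hNc] at hle
  omega

/-- A bound on a `1/2`-net controls a linear form on the unit ball up to the factor `2`. -/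
lemma le_two_mul_of_net {N : Set E}
    (hN : ∀ y : E, ‖y‖ ≤ 1 → ∃ y₀ ∈ N, ‖y - y₀‖ ≤ 1 / 2) (f : E →ₗ[ℝ] ℝ) {s : ℝ}
    (hs : ∀ y₀ ∈ N, f y₀ ≤ s) {y : E} (hy : ‖y‖ ≤ 1) : f y ≤ 2 * s := by
  let F : E →L[ℝ] ℝ := LinearMap.toContinuousLinearMap f
  have hF : ∀ y, F y = f y := fun _ => rfl
  have key : ∀ y : E, ‖y‖ ≤ 1 → F y ≤ s + ‖F‖ / 2 := by
    intro y hy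
    obtain ⟨y₀, hy₀, hd⟩ := hN y hy
    have h1 : F (y - y₀) ≤ ‖F‖ * (1 / 2) :=
      (le_abs_self _).trans ((F.le_opNorm _).trans
        (mul_le_mul_of_nonneg_left hd (norm_nonneg _)))
    rw [map_sub] at h1
    linarith [hs y₀ hy₀, hF y₀]
  have h0 : 0 ≤ s + ‖F‖ / 2 := by simpa using key 0 (by simp)
  have hnorm : ‖F‖ ≤ s + ‖F‖ / 2 := by
    refine F.opNorm_le_of_unit_norm h0 fun y hy => abs_le'.2 ⟨key y hy.le, ?_⟩
    rw [← map_neg]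
    exact key (-y) (by rw [norm_neg, hy])
  have := key y hy
  rw [hF] at this
  linarith

end Nets

/-! ### The noise on blockwise rank-one matrices -/

section BlockForm

variable {n m : ℕ}

lemma frobInner_meanMatrix (G : CoClustering n m) (a a' : Matrix (Fin n) (Fin G.L) ℝ)
    (b b' : Matrix (Fin m) (Fin G.K) ℝ) :
    frobInner (meanMatrix G a b) (meanMatrix G a' b') =
      ∑ i, ∑ l, a i l * a' i l * ∑ j : {j // G.z j = l}, b j (G.c i) * b' j (G.c i) := by
  simp only [frobInner, meanMatrix, Matrix.of_apply]
  refine Finset.sum_congr rfl fun i _ => ?_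
  rw [← sum_fiberwise_subtype G.z]
  refine Finset.sum_congr rfl fun l _ => ?_
  rw [Finset.mul_sum]
  refine Finset.sum_congr rfl fun j _ => ?_
  rw [j.2]
  ring

lemma frobSq_eq_frobInner {ι κ : Type} [Fintype ι] [Fintype κ] (M : Matrix ι κ ℝ) :
    frobSq M = frobInner M M := by
  simp only [frobSq, frobInner, pow_two]

/-- The right factors of a blockwise rank-one matrix: a vector on the columns of the `l`-th column
group for every block `(k, l)`, with the largest of the Euclidean norms of these vectors. -/
abbrev ColFactor (G : CoClustering n m) : Type :=
  Fin G.K → (l : Fin G.L) → EuclideanSpace ℝ {j // G.z j = l}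

/-- The left factors of a blockwise rank-one matrix, with the Euclidean norm. -/
abbrev RowFactor (G : CoClustering n m) : Type := EuclideanSpace ℝ (Fin n × Fin G.L)

/-- The blockwise rank-one matrix with the given factors. It is bilinear in them, and
`‖x yᵀ‖_F ≤ ‖x‖ ‖y‖`. -/
def blockForm (G : CoClustering n m) (x : RowFactor G) (y : ColFactor G) :
    Matrix (Fin n) (Fin m) ℝ :=
  meanMatrix G (Matrix.of fun i l => x (i, l)) (Matrix.of fun j k => y k (G.z j) ⟨j, rfl⟩)

lemma frobSq_blockForm (G : CoClustering n m) (x : RowFactor G) (y : ColFactor G) :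
    frobSq (blockForm G x y) = ∑ i, ∑ l, x (i, l) ^ 2 * ‖y (G.c i) l‖ ^ 2 := by
  rw [frobSq_eq_frobInner, blockForm, frobInner_meanMatrix]
  refine Finset.sum_congr rfl fun i _ => Finset.sum_congr rfl fun l _ => ?_
  simp only [Matrix.of_apply]
  rw [EuclideanSpace.real_norm_sq_eq, ← pow_two]
  congr 1
  refine Finset.sum_congr rfl fun j _ => ?_
  obtain ⟨j, rfl⟩ := j
  rw [pow_two]

lemma frobSq_blockForm_le_one (G : CoClustering n m) {x : RowFactor G} {y : ColFactor G}
    (hx : ‖x‖ ≤ 1) (hy : ‖y‖ ≤ 1) : frobSq (blockForm G x y) ≤ 1 := by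
  calc frobSq (blockForm G x y) ≤ ∑ i, ∑ l, x (i, l) ^ 2 := by
        rw [frobSq_blockForm]
        refine Finset.sum_le_sum fun i _ => Finset.sum_le_sum fun l _ => ?_
        refine mul_le_of_le_one_right (sq_nonneg _) ?_
        exact pow_le_one₀ (norm_nonneg _)
          (((norm_le_pi_norm _ l).trans (norm_le_pi_norm y _)).trans hy)
    _ = ‖x‖ ^ 2 := by rw [EuclideanSpace.real_norm_sq_eq, Fintype.sum_prod_type]
    _ ≤ 1 := pow_le_one₀ (norm_nonneg _) hx

/-- Every blockwise rank-one matrix is a `blockForm` with right factors of norm at most one; then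
the norm of the left factor is the Frobenius norm of the matrix. -/
lemma exists_blockForm_eq (G : CoClustering n m) (a : Matrix (Fin n) (Fin G.L) ℝ)
    (b : Matrix (Fin m) (Fin G.K) ℝ) : ∃ (x : RowFactor G) (y : ColFactor G), ‖y‖ ≤ 1 ∧
      meanMatrix G a b = blockForm G x y ∧ ‖x‖ = Real.sqrt (frobSq (meanMatrix G a b)) := by
  let w : ColFactor G := fun k l => WithLp.toLp 2 fun j => b j k
  let x : RowFactor G := WithLp.toLp 2 fun p => a p.1 p.2 * ‖w (G.c p.1) p.2‖
  let y : ColFactor G := fun k l => ‖w k l‖⁻¹ • w k l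
  have hnorm : ∀ k l, ‖y k l‖ = ‖w k l‖⁻¹ * ‖w k l‖ := fun k l => by
    rw [norm_smul, norm_inv, norm_norm]
  refine ⟨x, y, ?_, ?_, ?_⟩
  · refine (pi_norm_le_iff_of_nonneg zero_le_one).2 fun k =>
      (pi_norm_le_iff_of_nonneg zero_le_one).2 fun l => ?_
    rw [hnorm]
    exact inv_mul_le_one
  · ext i j
    change a i (G.z j) * b j (G.c i) = a i (G.z j) * ‖w (G.c i) (G.z j)‖ *
      (‖w (G.c i) (G.z j)‖⁻¹ * b j (G.c i))
    rcases eq_or_ne ‖w (G.c i) (G.z j)‖ 0 with h | h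
    · have hb : b j (G.c i) = 0 := by
        have := congrArg (fun v : EuclideanSpace ℝ {j' // G.z j' = G.z j} => v ⟨j, rfl⟩)
          (norm_eq_zero.1 h)
        simpa [w] using this
      simp [hb]
    · field_simp
  · rw [eq_comm, Real.sqrt_eq_iff_eq_sq (frobSq_nonneg _) (norm_nonneg _),
      EuclideanSpace.real_norm_sq_eq, Fintype.sum_prod_type, frobSq_eq_frobInner,
      frobInner_meanMatrix]
    refine Finset.sum_congr rfl fun i _ => Finset.sum_congr rfl fun l _ => ?_
    change _ = (a i l * ‖w (G.c i) l‖) ^ 2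
    rw [mul_pow, EuclideanSpace.real_norm_sq_eq, ← pow_two]
    simp only [w, pow_two]

lemma finrank_colFactor (G : CoClustering n m) : Module.finrank ℝ (ColFactor G) = m * G.K := by
  have h : ∑ l, Fintype.card {j // G.z j = l} = m := by
    rw [← Fintype.card_sigma, Fintype.card_congr (Equiv.sigmaFiberEquiv G.z), Fintype.card_fin]
  simp only [Module.finrank_pi_fintype, finrank_euclideanSpace, h, Finset.sum_const,
    Finset.card_univ, Fintype.card_fin, smul_eq_mul]
  exact mul_comm _ _

lemma finrank_rowFactor (G : CoClustering n m) : Module.finrank ℝ (RowFactor G) = n * G.L := by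
  simp

/-- The noise against `blockForm G x y`, as a linear form in `y`. -/
def noiseCol (G : CoClustering n m) (ξ : Matrix (Fin n) (Fin m) ℝ) (x : RowFactor G) :
    ColFactor G →ₗ[ℝ] ℝ where
  toFun y := frobInner ξ (blockForm G x y)
  map_add' y y' := by
    rw [← frobInner_add_right]
    congr 1
    ext i j
    exact mul_add _ _ _
  map_smul' r y := by
    rw [RingHom.id_apply, smul_eq_mul, ← frobInner_smul_right]
    congr 1
    ext i j
    exact mul_left_comm _ _ _

/-- The noise against `blockForm G x y`, as a linear form in `x`. -/
def noiseRow (G : CoClustering n m) (ξ : Matrix (Fin n) (Fin m) ℝ) (y : ColFactor G) :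
    RowFactor G →ₗ[ℝ] ℝ where
  toFun x := frobInner ξ (blockForm G x y)
  map_add' x x' := by
    rw [← frobInner_add_right]
    congr 1
    ext i j
    exact add_mul _ _ _
  map_smul' r x := by
    rw [RingHom.id_apply, smul_eq_mul, ← frobInner_smul_right]
    congr 1
    ext i j
    exact mul_assoc _ _ _

/-- Finitely many blockwise rank-one matrices in the Frobenius unit ball control the noise on all
blockwise rank-one matrices. -/
theorem exists_finset_meanMatrix_net (G : CoClustering n m) :
    ∃ N : Finset (Matrix (Fin n) (Fin m) ℝ), N.card ≤ 5 ^ (n * G.L + m * G.K) ∧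
      (∀ H ∈ N, frobSq H ≤ 1) ∧
      ∀ (ξ : Matrix (Fin n) (Fin m) ℝ) (s : ℝ), (∀ H ∈ N, frobInner ξ H ≤ s) →
        ∀ a b, frobInner ξ (meanMatrix G a b) ≤
          4 * s * Real.sqrt (frobSq (meanMatrix G a b)) := by
  classical
  obtain ⟨NX, hXc, hX1, hX⟩ := exists_net_unitBall (RowFactor G)
  obtain ⟨NY, hYc, hY1, hY⟩ := exists_net_unitBall (ColFactor G)
  rw [finrank_rowFactor] at hXc
  rw [finrank_colFactor] at hYc
  refine ⟨(NX ×ˢ NY).image fun p => blockForm G p.1 p.2, ?_, ?_, ?_⟩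
  · refine Finset.card_image_le.trans ?_
    rw [Finset.card_product, pow_add]
    exact Nat.mul_le_mul hXc hYc
  · simp only [Finset.mem_image, Finset.mem_product]
    rintro _ ⟨p, ⟨h1, h2⟩, rfl⟩
    exact frobSq_blockForm_le_one G (hX1 _ h1) (hY1 _ h2)
  · intro ξ s hs a b
    have hunit : ∀ x : RowFactor G, ‖x‖ ≤ 1 → ∀ y : ColFactor G, ‖y‖ ≤ 1 →
        frobInner ξ (blockForm G x y) ≤ 4 * s := by
      intro x hx y hy
      have h : noiseCol G ξ x y ≤ 2 * (2 * s) := by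
        refine le_two_mul_of_net (N := (NY : Set (ColFactor G))) hY _ (fun y₀ hy₀ => ?_) hy
        change noiseRow G ξ y₀ x ≤ 2 * s
        refine le_two_mul_of_net (N := (NX : Set (RowFactor G))) hX _ (fun x₀ hx₀ => ?_) hx
        exact hs _ (Finset.mem_image.2 ⟨(x₀, y₀), Finset.mem_product.2 ⟨hx₀, hy₀⟩, rfl⟩)
      calc frobInner ξ (blockForm G x y) ≤ 2 * (2 * s) := h
        _ = 4 * s := by ring
    obtain ⟨x, y, hy, hxy, hx⟩ := exists_blockForm_eq G a b
    rw [← hx, hxy]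
    change noiseRow G ξ y x ≤ _
    rcases eq_or_ne x 0 with rfl | hx0
    · simp
    have hpos : 0 < ‖x‖ := norm_pos_iff.2 hx0
    have h : noiseRow G ξ y (‖x‖⁻¹ • x) ≤ 4 * s := hunit _ (by
      rw [norm_smul, norm_inv, norm_norm, inv_mul_cancel₀ hpos.ne']) y hy
    rwa [map_smul, smul_eq_mul, inv_mul_le_iff₀ hpos, mul_comm] at h

/-- The difference of two blockwise rank-one matrices is an orthogonal sum of two: orthogonalize
the right factors in every block. -/
theorem exists_orthogonal_meanMatrix (G : CoClustering n m) (a a' : Matrix (Fin n) (Fin G.L) ℝ)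
    (b b' : Matrix (Fin m) (Fin G.K) ℝ) : ∃ p q : Matrix (Fin m) (Fin G.K) ℝ,
      ∃ e f : Matrix (Fin n) (Fin G.L) ℝ,
      meanMatrix G a b - meanMatrix G a' b' = meanMatrix G e p + meanMatrix G f q ∧
      frobSq (meanMatrix G a b - meanMatrix G a' b') =
        frobSq (meanMatrix G e p) + frobSq (meanMatrix G f q) := by
  let d : Fin G.K → Fin G.L → ℝ := fun k l => ∑ j : {j // G.z j = l}, b j k * b j k
  -- where `d = 0` the vector `b` vanishes, and the value `0` of the quotient is the right one
  let θ : Fin G.K → Fin G.L → ℝ := fun k l =>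
    (∑ j : {j // G.z j = l}, b j k * b' j k) / d k l
  let e : Matrix (Fin n) (Fin G.L) ℝ := fun i l => a i l - θ (G.c i) l * a' i l
  let q : Matrix (Fin m) (Fin G.K) ℝ := fun j k => b' j k - θ k (G.z j) * b j k
  have hsum : meanMatrix G a b - meanMatrix G a' b' =
      meanMatrix G e b + meanMatrix G (-a') q := by
    ext i j
    simp only [meanMatrix, Matrix.sub_apply, Matrix.add_apply, Matrix.of_apply, Matrix.neg_apply,
      e, q]
    ring
  refine ⟨b, q, e, -a', hsum, ?_⟩
  have horth : frobInner (meanMatrix G e b) (meanMatrix G (-a') q) = 0 := by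
    rw [frobInner_meanMatrix]
    refine Finset.sum_eq_zero fun i _ => Finset.sum_eq_zero fun l _ => ?_
    have h1 : ∀ j : {j // G.z j = l}, b j (G.c i) * q j (G.c i) =
        b j (G.c i) * b' j (G.c i) - θ (G.c i) l * (b j (G.c i) * b j (G.c i)) := by
      rintro ⟨j, rfl⟩
      simp only [q]
      ring
    simp only [h1, Finset.sum_sub_distrib, ← Finset.mul_sum]
    have h2 : ∑ j : {j // G.z j = l}, b j (G.c i) * b' j (G.c i) = θ (G.c i) l * d (G.c i) l := by
      by_cases hd : d (G.c i) l = 0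
      · have hz := (Finset.sum_eq_zero_iff_of_nonneg fun (j : {j // G.z j = l}) _ =>
          mul_self_nonneg (b j (G.c i))).1 hd
        rw [hd, mul_zero]
        refine Finset.sum_eq_zero fun j hj => ?_
        rw [mul_self_eq_zero.1 (hz j hj), zero_mul]
      · rw [div_mul_cancel₀ _ hd]
    rw [h2, sub_self, mul_zero]
  have h := frobSq_sub (meanMatrix G e b) ((-1 : ℝ) • meanMatrix G (-a') q)
  rw [frobInner_smul_right, horth, frobSq_smul] at h
  rw [hsum]
  calc _ = frobSq (meanMatrix G e b - (-1 : ℝ) • meanMatrix G (-a') q) := by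
        congr 1
        rw [neg_one_smul, sub_neg_eq_add]
    _ = _ := by rw [h]; ring

lemma two_mul_le_of_le_mul_sqrt {α x T r : ℝ} (hα : 0 < α) (hr : 0 ≤ r)
    (h : x ≤ T * Real.sqrt r) : 2 * x ≤ α * r + T ^ 2 / α := by
  have h1 : α * r + T ^ 2 / α - 2 * (T * Real.sqrt r) = (α * Real.sqrt r - T) ^ 2 / α := by
    nth_rewrite 1 [← Real.sq_sqrt hr]
    field_simp
    ring
  have h2 : 0 ≤ (α * Real.sqrt r - T) ^ 2 / α := by positivity
  linarith

lemma frobSq_sub_comm {ι κ : Type} [Fintype ι] [Fintype κ] (M N : Matrix ι κ ℝ) :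
    frobSq (M - N) = frobSq (N - M) := by
  simp only [frobSq, Matrix.sub_apply]
  exact Finset.sum_congr rfl fun _ _ => Finset.sum_congr rfl fun _ _ => by ring

lemma frobSq_sub_le_two_mul {ι κ : Type} [Fintype ι] [Fintype κ] (M N : Matrix ι κ ℝ) :
    frobSq (M - N) ≤ 2 * frobSq M + 2 * frobSq N := by
  simp only [frobSq, Finset.mul_sum, ← Finset.sum_add_distrib, Matrix.sub_apply]
  exact Finset.sum_le_sum fun i _ => Finset.sum_le_sum fun j _ => by
    nlinarith [sq_nonneg (M i j + N i j)]

/-- The oracle inequality on the event where the noise is controlled. The error `B - P` is split at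
the best blockwise rank-one approximation `W` of `P` under the assignment of `B`: the direction of
`W - P` does not depend on the noise, and `B - W` has blocks of rank at most two and norm at most
`2 ‖B - P‖`. -/
theorem frobSq_sub_mul_le {α₁ α₂ p p₀ g T : ℝ} (hα₁ : 0 < α₁) (hα₂ : 0 < α₂)
    (G : CoClustering n m) {A P B W : Matrix (Fin n) (Fin m) ℝ}
    (hB : ∃ a b, B = meanMatrix G a b) (hW : ∃ a b, W = meanMatrix G a b)
    (hWB : frobSq (W - P) ≤ frobSq (B - P))
    (hmin : frobSq (A - B) + p ≤ frobSq (A - P) + p₀)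
    (hg : frobInner (A - P) (W - P) ≤ g * Real.sqrt (frobSq (W - P)))
    (hT : ∀ a b, frobInner (A - P) (meanMatrix G a b) ≤
      T * Real.sqrt (frobSq (meanMatrix G a b))) :
    (1 - α₁ - 4 * α₂) * frobSq (B - P) ≤ g ^ 2 / α₁ + 2 * T ^ 2 / α₂ + p₀ - p := by
  obtain ⟨a, b, hab⟩ := hB
  obtain ⟨a', b', hab'⟩ := hW
  obtain ⟨e₂, f₂, e₁, f₁, hR, hR2⟩ := exists_orthogonal_meanMatrix G a a' b b'
  rw [← hab, ← hab'] at hR hR2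
  have h1 : frobSq (A - B) = frobSq (A - P) - 2 * frobInner (A - P) (B - P) + frobSq (B - P) := by
    rw [← frobSq_sub, sub_sub_sub_cancel_right]
  have h2 : frobInner (A - P) (B - P) = frobInner (A - P) (meanMatrix G e₁ e₂) +
      frobInner (A - P) (meanMatrix G f₁ f₂) + frobInner (A - P) (W - P) := by
    rw [← frobInner_add_right, ← hR, ← frobInner_add_right, sub_add_sub_cancel]
  have h3 := two_mul_le_of_le_mul_sqrt hα₂ (frobSq_nonneg _) (hT e₁ e₂)
  have h4 := two_mul_le_of_le_mul_sqrt hα₂ (frobSq_nonneg _) (hT f₁ f₂)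
  have h5 := two_mul_le_of_le_mul_sqrt hα₁ (frobSq_nonneg _) hg
  have h6 : frobSq (B - W) ≤ 4 * frobSq (B - P) := by
    have := frobSq_sub_le_two_mul (B - P) (W - P)
    rw [sub_sub_sub_cancel_right] at this
    linarith
  have h7 : α₂ * frobSq (B - W) ≤ α₂ * (4 * frobSq (B - P)) :=
    mul_le_mul_of_nonneg_left h6 hα₂.le
  have h8 : α₁ * frobSq (W - P) ≤ α₁ * frobSq (B - P) :=
    mul_le_mul_of_nonneg_left hWB hα₁.le
  rw [hR2] at h7
  have h9 : 2 * T ^ 2 / α₂ = T ^ 2 / α₂ + T ^ 2 / α₂ := by ring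
  rw [h9]
  linarith

end BlockForm

/-! ### Concentration of the noise -/

section Concentration

variable {n m : ℕ} {Ω : Type u} [MeasurableSpace Ω] {μ : Measure Ω}

lemma measureReal_sqrt_lt_le_exp {X : Ω → ℝ} {c : ℝ≥0} (h : HasSubgaussianMGF X c μ) {s u : ℝ}
    (hcs : c ≤ s) (hu : 0 ≤ u) : μ.real {ω | Real.sqrt (2 * s * u) < X ω} ≤ Real.exp (-u) := by
  have : IsFiniteMeasure μ := by
    have := h.integrable_exp_mul 0
    simp only [zero_mul, Real.exp_zero] at this
    exact (integrable_const_iff_isFiniteMeasure one_ne_zero).1 this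
  rcases eq_or_ne c 0 with rfl | hc
  · -- the Chernoff bound is void for variance proxy `0`, where the variable vanishes
    have h0 : μ {ω | Real.sqrt (2 * s * u) < X ω} = 0 := by
      refine measure_mono_null ?_ (ae_iff.1 h.ae_eq_zero_of_hasSubgaussianMGF_zero)
      intro ω hω
      exact ne_of_gt (lt_of_le_of_lt (Real.sqrt_nonneg _) hω)
    rw [measureReal_def, h0, ENNReal.toReal_zero]
    exact (Real.exp_pos _).le
  · have hc0 : (0 : ℝ) < c := by exact_mod_cast pos_iff_ne_zero.2 hc
    calc μ.real {ω | Real.sqrt (2 * s * u) < X ω}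
        ≤ μ.real {ω | Real.sqrt (2 * s * u) ≤ X ω} :=
          measureReal_mono (Set.ofPred_subset_ofPred.2 fun ω hω => le_of_lt hω)
      _ ≤ Real.exp (-Real.sqrt (2 * s * u) ^ 2 / (2 * c)) := h.measure_ge_le (Real.sqrt_nonneg _)
      _ ≤ Real.exp (-u) := by
          refine Real.exp_le_exp.2 ?_
          have hs : 0 ≤ s := hc0.le.trans hcs
          rw [Real.sq_sqrt (by positivity), div_le_iff₀ (by positivity)]
          nlinarith

variable {A : Ω → Matrix (Fin n) (Fin m) ℝ} {G : CoClustering n m}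
  {Λ : Matrix (Fin n) (Fin G.L) ℝ} {Λ' : Matrix (Fin m) (Fin G.K) ℝ} {v : Fin n → Fin m → ℝ≥0}

/-- The noise in a fixed direction of norm at most one is sub-Gaussian with variance proxy at most
`σ²_max`. -/
lemma IsModel.exists_hasSubgaussianMGF (h : IsModel μ A G Λ Λ' v)
    {H : Matrix (Fin n) (Fin m) ℝ} (hH : frobSq H ≤ 1) : ∃ c : ℝ≥0, c ≤ sigmaMaxSq v ∧
      HasSubgaussianMGF (fun ω => frobInner (A ω - meanMatrix G Λ Λ') H) c μ := by
  have hind : iIndepFun (fun (p : Fin n × Fin m) ω =>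
      H p.1 p.2 * (A ω p.1 p.2 - ∫ ω', A ω' p.1 p.2 ∂μ)) μ :=
    h.indep.comp (fun p x => H p.1 p.2 * (x - ∫ ω', A ω' p.1 p.2 ∂μ))
      fun p => by fun_prop
  have hsub := HasSubgaussianMGF.sum_of_iIndepFun (s := Finset.univ) hind
    fun p _ => (h.subG p.1 p.2).const_mul (H p.1 p.2)
  refine ⟨_, ?_, hsub.congr (Eventually.of_forall fun ω => ?_)⟩
  · rw [← NNReal.coe_le_coe]
    push_cast
    calc ∑ p : Fin n × Fin m, H p.1 p.2 ^ 2 * (v p.1 p.2 : ℝ)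
        ≤ ∑ p : Fin n × Fin m, H p.1 p.2 ^ 2 * (sigmaMaxSq v : ℝ) := by
          refine Finset.sum_le_sum fun p _ => mul_le_mul_of_nonneg_left ?_ (sq_nonneg _)
          exact_mod_cast Finset.le_sup (f := fun p : Fin n × Fin m => v p.1 p.2)
            (Finset.mem_univ p)
      _ = frobSq H * sigmaMaxSq v := by rw [← Finset.sum_mul, Fintype.sum_prod_type]; rfl
      _ ≤ sigmaMaxSq v := mul_le_of_le_one_left NNReal.zero_le_coe hH
  · simp only [frobInner, ← Fintype.sum_prod_type', Matrix.sub_apply, h.mean]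
    exact Finset.sum_congr rfl fun p _ => mul_comm _ _

lemma IsModel.measureReal_frobInner_le (h : IsModel μ A G Λ Λ' v)
    {H : Matrix (Fin n) (Fin m) ℝ} (hH : frobSq H ≤ 1) {u : ℝ} (hu : 0 ≤ u) :
    μ.real {ω | Real.sqrt (2 * sigmaMaxSq v * u) < frobInner (A ω - meanMatrix G Λ Λ') H}
      ≤ Real.exp (-u) := by
  obtain ⟨c, hc, hsub⟩ := h.exists_hasSubgaussianMGF hH
  exact measureReal_sqrt_lt_le_exp hsub (by exact_mod_cast hc) hu

lemma five_le_exp_two : (5 : ℝ) ≤ Real.exp 2 := by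
  have := Real.quadratic_le_exp_of_nonneg (x := 2) (by norm_num)
  norm_num at this
  exact this

/-- For a fixed assignment `G'`, off a set of probability at most `2 e^{-u}`, the noise is
controlled on all blockwise rank-one matrices and in the direction of the approximation error of
the mean matrix. -/
theorem IsModel.exists_bad_set [IsFiniteMeasure μ] (h : IsModel μ A G Λ Λ' v)
    (G' : CoClustering n m) {u : ℝ} (hu : 0 ≤ u) :
    ∃ (E : Set Ω) (W : Matrix (Fin n) (Fin m) ℝ), μ.real E ≤ 2 * Real.exp (-u) ∧
      (∃ a b, W = meanMatrix G' a b) ∧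
      (∀ a b, frobSq (W - meanMatrix G Λ Λ') ≤
        frobSq (meanMatrix G' a b - meanMatrix G Λ Λ')) ∧
      ∀ ω ∉ E, frobInner (A ω - meanMatrix G Λ Λ') (W - meanMatrix G Λ Λ') ≤
          Real.sqrt (2 * sigmaMaxSq v * u) * Real.sqrt (frobSq (W - meanMatrix G Λ Λ')) ∧
        ∀ a b, frobInner (A ω - meanMatrix G Λ Λ') (meanMatrix G' a b) ≤
          4 * Real.sqrt (2 * sigmaMaxSq v * (u + 2 * (n * G'.L + m * G'.K : ℕ))) *
            Real.sqrt (frobSq (meanMatrix G' a b)) := by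
  set P := meanMatrix G Λ Λ' with hP
  obtain ⟨W, hW⟩ := exists_isBlockProjection P G'
  obtain ⟨N, hNc, hN1, hN⟩ := exists_finset_meanMatrix_net G'
  set d : ℕ := n * G'.L + m * G'.K with hd
  set r := Real.sqrt (frobSq (W - P)) with hr
  have hrr : r ^ 2 = frobSq (W - P) := Real.sq_sqrt (frobSq_nonneg _)
  have hH : frobSq (r⁻¹ • (W - P)) ≤ 1 := by
    rw [frobSq_smul, ← hrr, ← mul_pow]
    exact pow_le_one₀ (by positivity) inv_mul_le_one
  let E₁ : Set Ω := {ω | Real.sqrt (2 * sigmaMaxSq v * u) < frobInner (A ω - P) (r⁻¹ • (W - P))}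
  let E₂ : Matrix (Fin n) (Fin m) ℝ → Set Ω := fun H =>
    {ω | Real.sqrt (2 * sigmaMaxSq v * (u + 2 * d)) < frobInner (A ω - P) H}
  refine ⟨E₁ ∪ ⋃ H ∈ N, E₂ H, W, ?_, hW.exists_eq_meanMatrix, fun a b => ?_, fun ω hω => ⟨?_, ?_⟩⟩
  · have h1 : μ.real E₁ ≤ Real.exp (-u) := h.measureReal_frobInner_le hH hu
    have h2 : μ.real (⋃ H ∈ N, E₂ H) ≤ Real.exp (-u) :=
      calc μ.real (⋃ H ∈ N, E₂ H) ≤ ∑ H ∈ N, μ.real (E₂ H) := measureReal_biUnion_finset_le _ _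
        _ ≤ ∑ _H ∈ N, Real.exp (-(u + 2 * d)) :=
            Finset.sum_le_sum fun H hH => h.measureReal_frobInner_le (hN1 H hH) (by positivity)
        _ = N.card * Real.exp (-(u + 2 * d)) := by rw [Finset.sum_const, nsmul_eq_mul]
        _ ≤ Real.exp 2 ^ d * Real.exp (-(u + 2 * d)) := by
            refine mul_le_mul_of_nonneg_right ?_ (Real.exp_pos _).le
            calc (N.card : ℝ) ≤ 5 ^ d := by exact_mod_cast hNc
              _ ≤ Real.exp 2 ^ d := pow_le_pow_left₀ (by norm_num) five_le_exp_two d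
        _ = Real.exp (-u) := by
            rw [← Real.exp_nat_mul, ← Real.exp_add]
            congr 1
            ring
    linarith [measureReal_union_le (μ := μ) E₁ (⋃ H ∈ N, E₂ H)]
  · rw [frobSq_sub_comm W, frobSq_sub_comm _ P]
    exact hW.frobSq_sub_le a b
  · rw [Set.mem_union, not_or] at hω
    have h1 := hω.1
    rw [Set.mem_ofPred_eq, not_lt, frobInner_smul_right] at h1
    rcases eq_or_lt_of_le (Real.sqrt_nonneg (frobSq (W - P))) with h0 | h0
    · have h2 := frobInner_sq_le (A ω - P) (W - P)
      rw [← hrr, hr, ← h0] at h2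
      rw [← h0, mul_zero]
      nlinarith
    · rw [inv_mul_le_iff₀ h0] at h1
      rwa [mul_comm] at h1
  · refine hN _ _ fun H hHN => ?_
    rw [Set.mem_union, not_or] at hω
    have h2 := hω.2
    simp only [Set.mem_iUnion, not_exists] at h2
    have h3 := h2 H hHN
    rwa [Set.mem_ofPred_eq, not_lt] at h3

end Concentration

/-! ### The penalty -/

section Penalty

variable {n m : ℕ}

lemma F₂_nonneg (n m K L : ℕ) : 0 ≤ F₂ n m K L := by
  have h := Real.log_natCast_nonneg
  have := h n; have := h m; have := h K; have := h L
  unfold F₂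
  positivity

lemma F₂_mono {K K' L L' : ℕ} (hK : 0 < K') (hL : 0 < L') (hKK : K' ≤ K) (hLL : L' ≤ L) :
    F₂ n m K' L' ≤ F₂ n m K L := by
  unfold F₂
  gcongr

lemma log_two_mul_mul_nonneg {K L : ℕ} : 0 ≤ Real.log (2 * K * L) := by
  have := Real.log_natCast_nonneg (2 * K * L)
  exact_mod_cast this

lemma F₁_eq (C : ℝ) (n m K L : ℕ) : F₁ C n m K L =
    C * (n * L + m * K + K * L * Real.log (2 * K * L) + K * L * F₂ n m K L) := rfl

lemma F₁_nonneg {C : ℝ} (hC : 0 ≤ C) (n m K L : ℕ) : 0 ≤ F₁ C n m K L := by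
  rw [F₁_eq]
  have := F₂_nonneg n m K L
  have := log_two_mul_mul_nonneg (K := K) (L := L)
  positivity

lemma F₁_mono {C : ℝ} (hC : 0 ≤ C) {K K' L L' : ℕ} (hK : 0 < K') (hL : 0 < L') (hKK : K' ≤ K)
    (hLL : L' ≤ L) : F₁ C n m K' L' ≤ F₁ C n m K L := by
  rw [F₁_eq, F₁_eq]
  have := F₂_nonneg n m K' L'
  have := log_two_mul_mul_nonneg (K := K') (L := L')
  have := F₂_mono (n := n) (m := m) hK hL hKK hLL
  gcongr

lemma Pen_nonneg {C α₁ α₂ τ : ℝ} (hC : 0 ≤ C) (hα₁ : 0 < α₁) (hα₂ : 0 < α₂) (hτ : 0 ≤ τ)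
    (n m K L : ℕ) : 0 ≤ Pen C α₁ α₂ τ n m K L := by
  have := F₂_nonneg n m K L
  have := F₁_nonneg hC n m K L
  unfold Pen
  positivity

lemma Pen_mono {C α₁ α₂ τ : ℝ} (hC : 0 ≤ C) (hα₁ : 0 < α₁) (hα₂ : 0 < α₂) (hτ : 0 ≤ τ)
    {K K' L L' : ℕ} (hK : 0 < K') (hL : 0 < L') (hKK : K' ≤ K) (hLL : L' ≤ L) :
    Pen C α₁ α₂ τ n m K' L' ≤ Pen C α₁ α₂ τ n m K L := by
  have := F₁_mono (n := n) (m := m) hC hK hL hKK hLL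
  have := F₂_mono (n := n) (m := m) hK hL hKK hLL
  unfold Pen
  gcongr

lemma le_F₁ {C : ℝ} (hC : 0 ≤ C) {K L : ℕ} (hK : 0 < K) (hL : 0 < L) :
    C * (n * L + m * K + F₂ n m K L) ≤ F₁ C n m K L := by
  rw [F₁_eq]
  refine mul_le_mul_of_nonneg_left ?_ hC
  have h1 : (1 : ℝ) ≤ K * L := by exact_mod_cast Nat.mul_pos hK hL
  have h2 := F₂_nonneg n m K L
  have h3 := mul_nonneg (zero_le_one.trans h1) (log_two_mul_mul_nonneg (K := K) (L := L))
  nlinarith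

/-- The term `F₂` is the price of the union bound over the assignments with `K` and `L` labels and
over `K ≤ n`, `L ≤ m`. -/
lemma exp_neg_F₂ {K L : ℕ} (hn : 0 < n) (hm : 0 < m) (hK : 0 < K) (hL : 0 < L) :
    Real.exp (-F₂ n m K L) = ((K : ℝ) ^ n * n * L ^ m * m)⁻¹ := by
  have hn' : (0 : ℝ) < n := by exact_mod_cast hn
  have hm' : (0 : ℝ) < m := by exact_mod_cast hm
  have hK' : (0 : ℝ) < K := by exact_mod_cast hK
  have hL' : (0 : ℝ) < L := by exact_mod_cast hL
  rw [Real.exp_neg, F₂, Real.exp_add, Real.exp_add, Real.exp_add, Real.exp_nat_mul,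
    Real.exp_nat_mul, Real.exp_log hn', Real.exp_log hm', Real.exp_log hK', Real.exp_log hL']

end Penalty

/-! ### The oracle inequality -/

section Oracle

variable {n m : ℕ}

lemma CoClustering.K_pos (G : CoClustering n m) (hn : 0 < n) : 0 < G.K :=
  Fin.pos (G.c ⟨0, hn⟩)

lemma CoClustering.L_pos (G : CoClustering n m) (hm : 0 < m) : 0 < G.L :=
  Fin.pos (G.z ⟨0, hm⟩)

/-- The assignments with at most `n` row labels and at most `m` column labels; the numbers of
labels are the entries of the index plus one. -/
abbrev SmallAssignment (n m : ℕ) : Type :=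
  Σ p : Fin n × Fin m, (Fin n → Fin (p.1 + 1)) × (Fin m → Fin (p.2 + 1))

/-- The co-clustering of a small assignment. -/
def SmallAssignment.toCoClustering (I : SmallAssignment n m) : CoClustering n m :=
  ⟨I.1.1 + 1, I.1.2 + 1, I.2.1, I.2.2⟩

lemma exists_smallAssignment (G : CoClustering n m) (hn : 0 < n) (hm : 0 < m) (hK : G.K ≤ n)
    (hL : G.L ≤ m) : ∃ I : SmallAssignment n m, I.toCoClustering = G := by
  have h1 := G.K_pos hn
  have h2 := G.L_pos hm
  obtain ⟨K, L, c, z⟩ := G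
  obtain ⟨K, rfl⟩ := Nat.exists_eq_succ_of_ne_zero h1.ne'
  obtain ⟨L, rfl⟩ := Nat.exists_eq_succ_of_ne_zero h2.ne'
  exact ⟨⟨(⟨K, hK⟩, ⟨L, hL⟩), (c, z)⟩, rfl⟩

lemma sum_exp_neg_F₂ (hn : 0 < n) (hm : 0 < m) :
    ∑ I : SmallAssignment n m, Real.exp (-F₂ n m I.toCoClustering.K I.toCoClustering.L) = 1 := by
  have hn' : (0 : ℝ) < n := by exact_mod_cast hn
  have hm' : (0 : ℝ) < m := by exact_mod_cast hm
  rw [Fintype.sum_sigma]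
  have h : ∀ p : Fin n × Fin m, ∑ y : (Fin n → Fin (p.1 + 1)) × (Fin m → Fin (p.2 + 1)),
      Real.exp (-F₂ n m (SmallAssignment.toCoClustering ⟨p, y⟩).K
        (SmallAssignment.toCoClustering ⟨p, y⟩).L) = ((n : ℝ) * m)⁻¹ := by
    intro p
    simp only [SmallAssignment.toCoClustering,
      exp_neg_F₂ hn hm (Nat.succ_pos p.1) (Nat.succ_pos p.2), Finset.sum_const, Finset.card_univ,
      Fintype.card_prod, Fintype.card_fun, Fintype.card_fin, nsmul_eq_mul]
    push_cast
    field_simp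
  simp only [h, Finset.sum_const, Finset.card_univ, Fintype.card_prod, Fintype.card_fin,
    nsmul_eq_mul]
  push_cast
  field_simp

variable {Ω : Type u} [MeasurableSpace Ω] {μ : Measure Ω} [IsFiniteMeasure μ]
  {A : Ω → Matrix (Fin n) (Fin m) ℝ} {G : CoClustering n m}
  {Λ : Matrix (Fin n) (Fin G.L) ℝ} {Λ' : Matrix (Fin m) (Fin G.K) ℝ} {v : Fin n → Fin m → ℝ≥0}

/-- The basic inequality: the estimate is not worse than any blockwise rank-one matrix. -/
lemma IsPenalizedEstimate.frobSq_add_le {pen : ℕ → ℕ → ℝ} {M B : Matrix (Fin n) (Fin m) ℝ}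
    {Ĝ : CoClustering n m} (h : IsPenalizedEstimate pen M Ĝ B) (G : CoClustering n m)
    (a : Matrix (Fin n) (Fin G.L) ℝ) (b : Matrix (Fin m) (Fin G.K) ℝ) :
    frobSq (M - B) + pen Ĝ.K Ĝ.L ≤ frobSq (M - meanMatrix G a b) + pen G.K G.L := by
  obtain ⟨B', hB'⟩ := exists_isBlockProjection M G
  have h1 := h.2 G B' hB'
  rw [objective_eq, objective_eq] at h1
  linarith [hB'.frobSq_sub_le a b]

/-- The penalty of the estimate absorbs the noise bounds when `C = 64`: the control on a net enters
as `T² = 16 · 2σ(f₂ + t + 2d)`, so that `2 T² / α₂` costs `64 σ (f₂ + 2d + t) / α₂`, against the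
term `2 τ f₁ / α₂` of the penalty. -/
lemma frobSq_le_of_mul_le {α₁ α₂ τ σ t x f₁ f₂ d p₀ : ℝ} (hα₁ : 0 < α₁) (hα₂ : 0 < α₂)
    (hα : α₁ + 4 * α₂ < 1) (hσ : 0 ≤ σ) (hστ : σ ≤ τ) (ht : 0 ≤ t) (hf₂ : 0 ≤ f₂)
    (hf₁ : 64 * (d + f₂) ≤ f₁) (hd : 0 ≤ d)
    (h : (1 - α₁ - 4 * α₂) * x ≤ 2 * σ * (f₂ + t) / α₁ +
      2 * (16 * (2 * σ * (f₂ + t + 2 * d))) / α₂ + p₀ -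
        2 * τ * ((1 + 1 / α₂) * f₁ + 1 / α₁ * f₂)) :
    x ≤ H₁ α₁ α₂ * p₀ + H₂ 64 α₁ α₂ * σ * t := by
  have hden : 0 < 1 - α₁ - 4 * α₂ := by linarith
  have e : H₁ α₁ α₂ * p₀ + H₂ 64 α₁ α₂ * σ * t =
      (p₀ + (2 * 64 + 2 / α₁ + 2 * 64 / α₂) * σ * t) / (1 - α₁ - 4 * α₂) := by
    unfold H₁ H₂
    field_simp
  rw [e, le_div_iff₀ hden, mul_comm]
  refine h.trans ?_
  have hf₁0 : 0 ≤ f₁ := le_trans (by positivity) hf₁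
  have h1 : 2 * σ * ((1 + 1 / α₂) * f₁ + 1 / α₁ * f₂) ≤
      2 * τ * ((1 + 1 / α₂) * f₁ + 1 / α₁ * f₂) := by gcongr
  have h2 : 2 * (16 * (2 * σ * (f₂ + t + 2 * d))) / α₂ ≤ σ * (2 * f₁ + 64 * t) / α₂ := by
    refine div_le_div_of_nonneg_right ?_ hα₂.le
    have : σ * (64 * f₂ + 128 * d) ≤ σ * (2 * f₁) :=
      mul_le_mul_of_nonneg_left (by linarith) hσ
    linarith
  have h3 : 0 ≤ 2 * σ * f₁ + 128 * σ * t + 64 * σ * t / α₂ := by positivity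
  have e1 : 2 * σ * ((1 + 1 / α₂) * f₁ + 1 / α₁ * f₂) =
      2 * σ * f₁ + 2 * σ * f₁ / α₂ + 2 * σ * f₂ / α₁ := by ring
  have e2 : 2 * σ * (f₂ + t) / α₁ = 2 * σ * f₂ / α₁ + 2 * σ * t / α₁ := by ring
  have e3 : σ * (2 * f₁ + 64 * t) / α₂ = 2 * σ * f₁ / α₂ + 64 * σ * t / α₂ := by ring
  have e4 : (2 * 64 + 2 / α₁ + 2 * 64 / α₂) * σ * t =
      128 * σ * t + 2 * σ * t / α₁ + 128 * σ * t / α₂ := by ring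
  have e5 : 128 * σ * t / α₂ = 64 * σ * t / α₂ + 64 * σ * t / α₂ := by ring
  linarith

/-- The tail bound for the error of the penalized estimate: a union bound over the assignments with
at most `n` and `m` labels, to which that of the estimate is reduced by dropping unused labels. -/
theorem IsModel.measureReal_lt_frobSq_le (h : IsModel μ A G Λ Λ' v) (hn : 0 < n) (hm : 0 < m)
    {α₁ α₂ τ : ℝ} (hα₁ : 0 < α₁) (hα₂ : 0 < α₂) (hα : α₁ + 4 * α₂ < 1)
    (hτ : (sigmaMaxSq v : ℝ) ≤ τ) {Ghat : Ω → CoClustering n m}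
    {Phat : Ω → Matrix (Fin n) (Fin m) ℝ}
    (hest : ∀ ω, IsPenalizedEstimate (Pen 64 α₁ α₂ τ n m) (A ω) (Ghat ω) (Phat ω))
    {t : ℝ} (ht : 0 ≤ t) :
    μ.real {ω | H₁ α₁ α₂ * Pen 64 α₁ α₂ τ n m G.K G.L + H₂ 64 α₁ α₂ * sigmaMaxSq v * t <
      frobSq (Phat ω - meanMatrix G Λ Λ')} ≤ 2 * Real.exp (-t) := by
  have hτ0 : 0 ≤ τ := NNReal.zero_le_coe.trans hτ
  have hu : ∀ I : SmallAssignment n m,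
      0 ≤ F₂ n m I.toCoClustering.K I.toCoClustering.L + t := fun I =>
    add_nonneg (F₂_nonneg _ _ _ _) ht
  choose E W hE hW hWmin hgood using fun I : SmallAssignment n m =>
    h.exists_bad_set I.toCoClustering (hu I)
  calc _ ≤ μ.real (⋃ I, E I) := measureReal_mono ?_
    _ ≤ ∑ I, μ.real (E I) := measureReal_iUnion_fintype_le _
    _ ≤ ∑ I : SmallAssignment n m,
        2 * Real.exp (-(F₂ n m I.toCoClustering.K I.toCoClustering.L + t)) :=
          Finset.sum_le_sum fun I _ => hE I
    _ = 2 * Real.exp (-t) *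
        ∑ I : SmallAssignment n m, Real.exp (-F₂ n m I.toCoClustering.K I.toCoClustering.L) := by
          rw [Finset.mul_sum]
          refine Finset.sum_congr rfl fun I _ => ?_
          rw [neg_add, Real.exp_add]
          ring
    _ = 2 * Real.exp (-t) := by rw [sum_exp_neg_F₂ hn hm, mul_one]
  intro ω hω
  by_contra hnot
  simp only [Set.mem_iUnion, not_exists] at hnot
  refine not_lt.2 ?_ (Set.mem_ofPred_eq.mp hω)
  obtain ⟨a, b, hab⟩ := (hest ω).1.exists_eq_meanMatrix
  obtain ⟨G', a', b', hKn, hLm, hKK, hLL, hab'⟩ := exists_meanMatrix_eq_of_le (Ghat ω) a b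
  rw [hab'] at hab
  obtain ⟨I, rfl⟩ := exists_smallAssignment G' hn hm hKn hLm
  have hK := I.toCoClustering.K_pos hn
  have hL := I.toCoClustering.L_pos hm
  have hmin : frobSq (A ω - Phat ω) +
      Pen 64 α₁ α₂ τ n m I.toCoClustering.K I.toCoClustering.L ≤
      frobSq (A ω - meanMatrix G Λ Λ') + Pen 64 α₁ α₂ τ n m G.K G.L :=
    (add_le_add_right (Pen_mono (by norm_num) hα₁ hα₂ hτ0 hK hL hKK hLL) _).trans
      ((hest ω).frobSq_add_le G Λ Λ')
  obtain ⟨hg, hT⟩ := hgood I ω (hnot I)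
  have key := frobSq_sub_mul_le hα₁ hα₂ I.toCoClustering ⟨a', b', hab⟩ (hW I)
    (by rw [hab]; exact hWmin I a' b') hmin hg hT
  rw [mul_pow, Real.sq_sqrt (by have := hu I; positivity),
    Real.sq_sqrt (by have := hu I; positivity)] at key
  refine frobSq_le_of_mul_le (d := (n * I.toCoClustering.L + m * I.toCoClustering.K : ℕ))
    (f₂ := F₂ n m I.toCoClustering.K I.toCoClustering.L)
    (f₁ := F₁ 64 n m I.toCoClustering.K I.toCoClustering.L) hα₁ hα₂ hα NNReal.zero_le_coe hτ ht
    (F₂_nonneg _ _ _ _) ?_ (Nat.cast_nonneg _) ?_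
  · push_cast
    exact le_F₁ (by norm_num) hK hL
  · rw [show (4 : ℝ) ^ 2 = 16 by norm_num] at key
    exact key

end Oracle

/-! ### Risk bounds -/

/-- A tail bound `μ (a + b t < X) ≤ 3 e^{-t}` integrates to `E X ≤ a + 3 b`. -/
theorem integrable_and_integral_le_of_tail {Ω : Type u} [MeasurableSpace Ω] {μ : Measure Ω}
    [IsProbabilityMeasure μ] {X : Ω → ℝ} (hX : Measurable X) (hX0 : ∀ ω, 0 ≤ X ω) {a b : ℝ}
    (hb : 0 ≤ b) (htail : ∀ t, 0 ≤ t → μ.real {ω | a + b * t < X ω} ≤ 3 * Real.exp (-t)) :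
    Integrable X μ ∧ ∫ ω, X ω ∂μ ≤ a + 3 * b := by
  have key : ∀ c, b < c → Integrable X μ ∧ ∫ ω, X ω ∂μ ≤ a + 3 * c := by
    intro c hbc
    have hc : 0 < c := hb.trans_lt hbc
    let Y : Ω → ℝ := fun ω => max (X ω - a) 0
    have hY : Measurable Y := (hX.sub_const a).max measurable_const
    have hY0 : ∀ ω, 0 ≤ Y ω := fun ω => le_max_right _ _
    have hneg : -c⁻¹ < 0 := by simpa using hc
    have hexp : IntegrableOn (fun s : ℝ => 3 * Real.exp (-c⁻¹ * s)) (Set.Ioi 0) :=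
      (integrableOn_exp_mul_Ioi hneg 0).const_mul 3
    have hlin : ∫⁻ ω, ENNReal.ofReal (Y ω) ∂μ ≤ ENNReal.ofReal (3 * c) :=
      calc ∫⁻ ω, ENNReal.ofReal (Y ω) ∂μ = ∫⁻ s in Set.Ioi 0, μ {ω | s < Y ω} :=
            lintegral_eq_lintegral_meas_lt μ (Eventually.of_forall hY0) hY.aemeasurable
        _ ≤ ∫⁻ s in Set.Ioi 0, ENNReal.ofReal (3 * Real.exp (-c⁻¹ * s)) := by
            refine setLIntegral_mono' measurableSet_Ioi fun s hs => ?_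
            have hs0 : (0 : ℝ) < s := hs
            rw [← ofReal_measureReal]
            refine ENNReal.ofReal_le_ofReal ?_
            have hsub : {ω | s < Y ω} ⊆ {ω | a + b * (s / c) < X ω} := by
              intro ω hω
              have h0 : s < max (X ω - a) 0 := hω
              have h1 : s < X ω - a := (lt_max_iff.1 h0).resolve_right (not_lt.2 hs0.le)
              have h2 : b * (s / c) ≤ s := by
                rw [mul_div_assoc', div_le_iff₀ hc, mul_comm s]
                exact mul_le_mul_of_nonneg_right hbc.le hs0.le
              change a + b * (s / c) < X ω
              linarith
            refine (measureReal_mono hsub).trans ((htail (s / c) (by positivity)).trans_eq ?_)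
            congr 2
            ring
        _ = ENNReal.ofReal (∫ s in Set.Ioi 0, 3 * Real.exp (-c⁻¹ * s)) :=
            (ofReal_integral_eq_lintegral_ofReal hexp
              (Eventually.of_forall fun s => by positivity)).symm
        _ = ENNReal.ofReal (3 * c) := by
            rw [integral_const_mul, integral_exp_mul_Ioi hneg]
            simp
    have hYint : Integrable Y μ :=
      ⟨hY.aestronglyMeasurable, by
        rw [hasFiniteIntegral_iff_ofReal (Eventually.of_forall hY0)]
        exact hlin.trans_lt ENNReal.ofReal_lt_top⟩
    have hYle : ∫ ω, Y ω ∂μ ≤ 3 * c := by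
      rw [integral_eq_lintegral_of_nonneg_ae (Eventually.of_forall hY0) hY.aestronglyMeasurable]
      exact ENNReal.toReal_le_of_le_ofReal (by positivity) hlin
    have hXY : ∀ ω, X ω ≤ a + Y ω := fun ω => by
      linarith [le_max_left (X ω - a) 0]
    have hsum : Integrable (fun ω => a + Y ω) μ := (integrable_const a).add hYint
    have hXint : Integrable X μ := hsum.mono' hX.aestronglyMeasurable
      (Eventually.of_forall fun ω => by rw [Real.norm_of_nonneg (hX0 ω)]; exact hXY ω)
    refine ⟨hXint, (integral_mono hXint hsum hXY).trans ?_⟩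
    rw [integral_add (integrable_const a) hYint]
    simpa using hYle
  refine ⟨(key (b + 1) (by linarith)).1, le_of_forall_pos_le_add fun ε hε => ?_⟩
  have := (key (b + ε / 3) (by linarith)).2
  linarith

section Bounds

variable {n m : ℕ} {Ω : Type u} [MeasurableSpace Ω] {μ : Measure Ω} [IsProbabilityMeasure μ]
  {A : Ω → Matrix (Fin n) (Fin m) ℝ} {G : CoClustering n m}
  {Λ : Matrix (Fin n) (Fin G.L) ℝ} {Λ' : Matrix (Fin m) (Fin G.K) ℝ} {v : Fin n → Fin m → ℝ≥0}

lemma H₂_nonneg {C α₁ α₂ : ℝ} (hC : 0 ≤ C) (hα₁ : 0 < α₁) (hα₂ : 0 < α₂)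
    (hα : α₁ + 4 * α₂ < 1) : 0 ≤ H₂ C α₁ α₂ := by
  have : 0 < 1 - α₁ - 4 * α₂ := by linarith
  unfold H₂
  positivity

lemma measurable_frobSq_sub {B : Ω → Matrix (Fin n) (Fin m) ℝ}
    (hB : ∀ i j, Measurable fun ω => B ω i j) (P : Matrix (Fin n) (Fin m) ℝ) :
    Measurable fun ω => frobSq (B ω - P) := by
  simp only [frobSq, Matrix.sub_apply]
  exact Finset.measurable_fun_sum _ fun i _ => Finset.measurable_fun_sum _ fun j _ =>
    ((hB i j).sub_const _).pow_const 2

variable {α₁ α₂ τ : ℝ} {Ghat : Ω → CoClustering n m} {Phat : Ω → Matrix (Fin n) (Fin m) ℝ}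

theorem IsModel.one_sub_le_measureReal (h : IsModel μ A G Λ Λ' v) (hn : 0 < n) (hm : 0 < m)
    (hα₁ : 0 < α₁) (hα₂ : 0 < α₂) (hα : α₁ + 4 * α₂ < 1) (hτ : (sigmaMaxSq v : ℝ) ≤ τ)
    (hmeas : ∀ i j, Measurable fun ω => Phat ω i j)
    (hest : ∀ ω, IsPenalizedEstimate (Pen 64 α₁ α₂ τ n m) (A ω) (Ghat ω) (Phat ω))
    {t : ℝ} (ht : 0 ≤ t) :
    1 - 3 * Real.exp (-t) ≤ μ.real {ω |
      1 / (n * m : ℝ) * frobSq (Phat ω - meanMatrix G Λ Λ') ≤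
        H₁ α₁ α₂ / (n * m : ℝ) * Pen 64 α₁ α₂ τ n m G.K G.L +
          H₂ 64 α₁ α₂ * sigmaMaxSq v / (n * m : ℝ) * t} := by
  have hnm : (0 : ℝ) < n * m := by exact_mod_cast Nat.mul_pos hn hm
  have htail := h.measureReal_lt_frobSq_le hn hm hα₁ hα₂ hα hτ hest ht
  have hset : {ω | 1 / (n * m : ℝ) * frobSq (Phat ω - meanMatrix G Λ Λ') ≤
      H₁ α₁ α₂ / (n * m : ℝ) * Pen 64 α₁ α₂ τ n m G.K G.L +
        H₂ 64 α₁ α₂ * sigmaMaxSq v / (n * m : ℝ) * t} =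
      {ω | H₁ α₁ α₂ * Pen 64 α₁ α₂ τ n m G.K G.L + H₂ 64 α₁ α₂ * sigmaMaxSq v * t <
        frobSq (Phat ω - meanMatrix G Λ Λ')}ᶜ := by
    ext ω
    rw [Set.mem_compl_iff, Set.mem_ofPred_eq, Set.mem_ofPred_eq, not_lt,
      show H₁ α₁ α₂ / (n * m : ℝ) * Pen 64 α₁ α₂ τ n m G.K G.L +
        H₂ 64 α₁ α₂ * sigmaMaxSq v / (n * m : ℝ) * t = 1 / (n * m : ℝ) *
        (H₁ α₁ α₂ * Pen 64 α₁ α₂ τ n m G.K G.L + H₂ 64 α₁ α₂ * sigmaMaxSq v * t) by ring]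
    exact mul_le_mul_iff_of_pos_left (one_div_pos.2 hnm)
  rw [hset, probReal_compl_eq_one_sub
    (measurableSet_lt measurable_const (measurable_frobSq_sub hmeas _))]
  linarith [Real.exp_pos (-t)]

theorem IsModel.integrable_and_integral_le (h : IsModel μ A G Λ Λ' v) (hn : 0 < n) (hm : 0 < m)
    (hα₁ : 0 < α₁) (hα₂ : 0 < α₂) (hα : α₁ + 4 * α₂ < 1) (hτ : (sigmaMaxSq v : ℝ) ≤ τ)
    (hmeas : ∀ i j, Measurable fun ω => Phat ω i j)
    (hest : ∀ ω, IsPenalizedEstimate (Pen 64 α₁ α₂ τ n m) (A ω) (Ghat ω) (Phat ω)) :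
    Integrable (fun ω => frobSq (Phat ω - meanMatrix G Λ Λ')) μ ∧
      1 / (n * m : ℝ) * ∫ ω, frobSq (Phat ω - meanMatrix G Λ Λ') ∂μ ≤
        H₁ α₁ α₂ / (n * m : ℝ) * Pen 64 α₁ α₂ τ n m G.K G.L +
          3 * H₂ 64 α₁ α₂ * sigmaMaxSq v / (n * m : ℝ) := by
  have hnm : (0 : ℝ) < n * m := by exact_mod_cast Nat.mul_pos hn hm
  obtain ⟨hint, hle⟩ := integrable_and_integral_le_of_tail
    (measurable_frobSq_sub hmeas (meanMatrix G Λ Λ')) (fun ω => frobSq_nonneg _)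
    (mul_nonneg (H₂_nonneg (by norm_num) hα₁ hα₂ hα) NNReal.zero_le_coe)
    fun t ht => (h.measureReal_lt_frobSq_le hn hm hα₁ hα₂ hα hτ hest ht).trans
      (by linarith [Real.exp_pos (-t)])
  refine ⟨hint, (mul_le_mul_of_nonneg_left hle (one_div_pos.2 hnm).le).trans_eq ?_⟩
  ring

end Bounds

/-! ### Consistency -/

section Consistency

lemma natCast_mul_one_add_log_le {p : ℕ} (hp : 0 < p) :
    (p : ℝ) * (1 + Real.log p) ≤ 1 + 3 * (p * Real.log p) := by
  have hlog : 0 ≤ Real.log p := Real.log_natCast_nonneg p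
  rcases Nat.lt_or_ge p 2 with h | h
  · obtain rfl : p = 1 := by omega
    simp
  · have h2 : (1 : ℝ) / 2 ≤ Real.log p :=
      (by linarith [Real.log_two_gt_d9] : (1 : ℝ) / 2 ≤ Real.log 2).trans
        (Real.log_le_log two_pos (by exact_mod_cast h))
    have hp' : (0 : ℝ) < p := by exact_mod_cast hp
    nlinarith

lemma F₂_le {n m K L : ℕ} (hK : 0 < K) (hL : 0 < L) :
    F₂ n m K L ≤ (n + m) * (1 + Real.log (K * L : ℕ)) := by
  have h1 : Real.log K ≤ Real.log (K * L : ℕ) :=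
    Real.log_le_log (by exact_mod_cast hK) (by exact_mod_cast Nat.le_mul_of_pos_right K hL)
  have h2 : Real.log L ≤ Real.log (K * L : ℕ) :=
    Real.log_le_log (by exact_mod_cast hL) (by exact_mod_cast Nat.le_mul_of_pos_left L hK)
  have h3 := Real.log_le_self (Nat.cast_nonneg (α := ℝ) n)
  have h4 := Real.log_le_self (Nat.cast_nonneg (α := ℝ) m)
  have h5 := mul_le_mul_of_nonneg_left h1 (Nat.cast_nonneg (α := ℝ) n)
  have h6 := mul_le_mul_of_nonneg_left h2 (Nat.cast_nonneg (α := ℝ) m)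
  unfold F₂
  linarith

lemma F₁_le {C : ℝ} (hC : 0 ≤ C) {n m K L : ℕ} (hn : 0 < n) (hm : 0 < m) (hK : 0 < K)
    (hL : 0 < L) :
    F₁ C n m K L ≤ C * (3 * ((n + m) * ((K * L : ℕ) * (1 + Real.log (K * L : ℕ))))) := by
  rw [F₁_eq]
  refine mul_le_mul_of_nonneg_left ?_ hC
  have hn' : (1 : ℝ) ≤ n := by exact_mod_cast hn
  have hm' : (1 : ℝ) ≤ m := by exact_mod_cast hm
  have hKL : (0 : ℝ) < (K * L : ℕ) := by exact_mod_cast Nat.mul_pos hK hL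
  have h1 : (K : ℝ) ≤ (K * L : ℕ) := by exact_mod_cast Nat.le_mul_of_pos_right K hL
  have h2 : (L : ℝ) ≤ (K * L : ℕ) := by exact_mod_cast Nat.le_mul_of_pos_left L hK
  have h3 := F₂_le (n := n) (m := m) hK hL
  have h4 : Real.log (2 * K * L) = Real.log 2 + Real.log (K * L : ℕ) := by
    rw [← Real.log_mul two_ne_zero hKL.ne']
    push_cast
    ring_nf
  have h5 : Real.log 2 ≤ 1 := by linarith [Real.log_two_lt_d9]
  have hcast : (K : ℝ) * L = (K * L : ℕ) := by push_cast; ring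
  have hlog : 0 ≤ Real.log (K * L : ℕ) := Real.log_natCast_nonneg _
  rw [h4, hcast]
  set p : ℝ := ((K * L : ℕ) : ℝ)
  set q : ℝ := Real.log p
  have h6 : (n : ℝ) * L + m * K ≤ (n + m) * (p * (1 + q)) := by
    have h7 : (n : ℝ) * L + m * K ≤ (n + m) * p := by nlinarith
    have h8 : 0 ≤ (n + m : ℝ) * (p * q) := by positivity
    linarith
  have h7 : p * (Real.log 2 + q) ≤ (n + m) * (p * (1 + q)) := by
    have h8 : p * (Real.log 2 + q) ≤ 1 * (p * (1 + q)) := by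
      rw [one_mul]
      exact mul_le_mul_of_nonneg_left (by linarith) hKL.le
    exact h8.trans (mul_le_mul_of_nonneg_right (by linarith) (by positivity))
  have h8 : p * F₂ n m K L ≤ p * ((n + m) * (1 + q)) := mul_le_mul_of_nonneg_left h3 hKL.le
  linarith

/-- Up to a constant, the penalty per entry is `K L (1 + log (K L)) / (n ∧ m)`. -/
lemma Pen_div_le {C α₁ α₂ τ : ℝ} (hC : 0 ≤ C) (hα₁ : 0 < α₁) (hα₂ : 0 < α₂) (hτ : 0 ≤ τ)
    {n m K L : ℕ} (hn : 0 < n) (hm : 0 < m) (hK : 0 < K) (hL : 0 < L) :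
    Pen C α₁ α₂ τ n m K L / (n * m : ℝ) ≤
      2 * τ * ((1 + 1 / α₂) * (C * 3) + 1 / α₁) * 2 *
        (1 / (min n m : ℕ) + 3 * ((K * L * Real.log (K * L) : ℝ) / (min n m : ℕ))) := by
  have hn' : (0 : ℝ) < n := by exact_mod_cast hn
  have hm' : (0 : ℝ) < m := by exact_mod_cast hm
  have hw : (0 : ℝ) < (min n m : ℕ) := by exact_mod_cast lt_min hn hm
  have hp1 : (1 : ℝ) ≤ (K * L : ℕ) := by exact_mod_cast Nat.mul_pos hK hL
  have h1 := F₁_le hC hn hm hK hL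
  have h2 := F₂_le (n := n) (m := m) hK hL
  have h3 := natCast_mul_one_add_log_le (Nat.mul_pos hK hL)
  have hlog : 0 ≤ Real.log (K * L : ℕ) := Real.log_natCast_nonneg _
  have hcast : (K : ℝ) * L = (K * L : ℕ) := by push_cast; ring
  rw [hcast]
  set p : ℝ := ((K * L : ℕ) : ℝ)
  set q : ℝ := Real.log p
  have hnm : (n + m : ℝ) / (n * m) ≤ 2 / (min n m : ℕ) := by
    rw [div_le_div_iff₀ (by positivity) hw]
    have ha : ((min n m : ℕ) : ℝ) ≤ n := by exact_mod_cast min_le_left n m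
    have hb : ((min n m : ℕ) : ℝ) ≤ m := by exact_mod_cast min_le_right n m
    nlinarith
  have h4 : F₂ n m K L ≤ (n + m) * (p * (1 + q)) := by
    refine h2.trans (mul_le_mul_of_nonneg_left ?_ (by positivity))
    exact le_mul_of_one_le_left (by positivity) hp1
  calc Pen C α₁ α₂ τ n m K L / (n * m : ℝ)
      ≤ (2 * τ * ((1 + 1 / α₂) * (C * (3 * ((n + m) * (p * (1 + q))))) +
          1 / α₁ * ((n + m) * (p * (1 + q))))) / (n * m : ℝ) := by
        unfold Pen
        gcongr
    _ = 2 * τ * ((1 + 1 / α₂) * (C * 3) + 1 / α₁) * ((n + m : ℝ) / (n * m) * (p * (1 + q))) := by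
        ring
    _ ≤ 2 * τ * ((1 + 1 / α₂) * (C * 3) + 1 / α₁) *
        (2 / (min n m : ℕ) * (1 + 3 * (p * q))) := by gcongr
    _ = _ := by ring

end Consistency

end TNPM

end

theorem theorem2 :
    ∃ C : ℝ, 0 < C ∧ ∀ α₁ α₂ : ℝ, 0 < α₁ → 0 < α₂ → α₁ + 4 * α₂ < 1 →
      -- the two bounds for fixed n, m
      (∀ (n m : ℕ), 0 < n → 0 < m →
        ∀ (Ω : Type u) [MeasurableSpace Ω] (μ : Measure Ω) [IsProbabilityMeasure μ]
          (A : Ω → Matrix (Fin n) (Fin m) ℝ) (G : TNPM.CoClustering n m)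
          (Λ : Matrix (Fin n) (Fin G.L) ℝ) (Λ' : Matrix (Fin m) (Fin G.K) ℝ)
          (v : Fin n → Fin m → ℝ≥0) (τ : ℝ)
          (Ghat : Ω → TNPM.CoClustering n m) (Phat : Ω → Matrix (Fin n) (Fin m) ℝ),
          TNPM.IsModel μ A G Λ Λ' v →
          (TNPM.sigmaMaxSq v : ℝ) ≤ τ →
          (∀ i j, Measurable fun ω => Phat ω i j) →
          (∀ ω, TNPM.IsPenalizedEstimate (TNPM.Pen C α₁ α₂ τ n m) (A ω) (Ghat ω) (Phat ω)) →
          (∀ ω, TNPM.frobSq (Phat ω - TNPM.meanMatrix G Λ Λ') =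
            ∑ k, ∑ l, TNPM.frobSq (TNPM.block (Ghat ω) (Phat ω) k l -
              TNPM.block (Ghat ω) (TNPM.meanMatrix G Λ Λ') k l)) ∧
          (∀ t : ℝ, 0 ≤ t →
            1 - 3 * Real.exp (-t) ≤ μ.real {ω |
              1 / (n * m : ℝ) * TNPM.frobSq (Phat ω - TNPM.meanMatrix G Λ Λ') ≤
                TNPM.H₁ α₁ α₂ / (n * m : ℝ) * TNPM.Pen C α₁ α₂ τ n m G.K G.L +
                  TNPM.H₂ C α₁ α₂ * TNPM.sigmaMaxSq v / (n * m : ℝ) * t}) ∧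
          Integrable (fun ω => TNPM.frobSq (Phat ω - TNPM.meanMatrix G Λ Λ')) μ ∧
          1 / (n * m : ℝ) * ∫ ω, TNPM.frobSq (Phat ω - TNPM.meanMatrix G Λ Λ') ∂μ ≤
            TNPM.H₁ α₁ α₂ / (n * m : ℝ) * TNPM.Pen C α₁ α₂ τ n m G.K G.L +
              3 * TNPM.H₂ C α₁ α₂ * TNPM.sigmaMaxSq v / (n * m : ℝ)) ∧
      -- consistency along a sequence of models
      (∀ (n m : ℕ → ℕ), (∀ r, 0 < n r) → (∀ r, 0 < m r) →
        ∀ (Ω : ℕ → Type u) [∀ r, MeasurableSpace (Ω r)] (μ : ∀ r, Measure (Ω r))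
          [∀ r, IsProbabilityMeasure (μ r)]
          (A : ∀ r, Ω r → Matrix (Fin (n r)) (Fin (m r)) ℝ)
          (G : ∀ r, TNPM.CoClustering (n r) (m r))
          (Λ : ∀ r, Matrix (Fin (n r)) (Fin (G r).L) ℝ)
          (Λ' : ∀ r, Matrix (Fin (m r)) (Fin (G r).K) ℝ)
          (v : ∀ r, Fin (n r) → Fin (m r) → ℝ≥0) (τ : ℝ)
          (Ghat : ∀ r, Ω r → TNPM.CoClustering (n r) (m r))
          (Phat : ∀ r, Ω r → Matrix (Fin (n r)) (Fin (m r)) ℝ),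
          (∀ r, TNPM.IsModel (μ r) (A r) (G r) (Λ r) (Λ' r) (v r)) →
          (∀ r, (TNPM.sigmaMaxSq (v r) : ℝ) ≤ τ) →
          (∀ r i j, Measurable fun ω => Phat r ω i j) →
          (∀ r ω, TNPM.IsPenalizedEstimate (TNPM.Pen C α₁ α₂ τ (n r) (m r))
            (A r ω) (Ghat r ω) (Phat r ω)) →
          Tendsto (fun r => min (n r) (m r)) atTop atTop →
          Tendsto (fun r => ((G r).K * (G r).L * Real.log ((G r).K * (G r).L) : ℝ) /
            (min (n r) (m r) : ℕ)) atTop (𝓝 0) →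
          Tendsto (fun r => TNPM.Pen C α₁ α₂ τ (n r) (m r) (G r).K (G r).L /
            (n r * m r : ℝ)) atTop (𝓝 0) ∧
          Tendsto (fun r => 1 / (n r * m r : ℝ) *
            ∫ ω, TNPM.frobSq (Phat r ω - TNPM.meanMatrix (G r) (Λ r) (Λ' r)) ∂(μ r))
            atTop (𝓝 0) ∧
          ∀ ε : ℝ, 0 < ε → Tendsto (fun r => (μ r).real {ω | ε ≤ 1 / (n r * m r : ℝ) *
            TNPM.frobSq (Phat r ω - TNPM.meanMatrix (G r) (Λ r) (Λ' r))})
            atTop (𝓝 0)) := by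
  refine ⟨64, by norm_num, fun α₁ α₂ hα₁ hα₂ hα => ⟨?_, ?_⟩⟩
  · intro n m hn hm Ω _ μ _ A G Λ Λ' v τ Ghat Phat h hτ hmeas hest
    refine ⟨fun ω => ?_, fun t ht => ?_, ?_⟩
    · simp only [← TNPM.block_sub, TNPM.sum_frobSq_block]
    · exact h.one_sub_le_measureReal hn hm hα₁ hα₂ hα hτ hmeas hest ht
    · exact h.integrable_and_integral_le hn hm hα₁ hα₂ hα hτ hmeas hest
  · intro n m hn hm Ω _ μ _ A G Λ Λ' v τ Ghat Phat h hτ hmeas hest hmin hKL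
    have hτ0 : 0 ≤ τ := NNReal.zero_le_coe.trans (hτ 0)
    have hw : ∀ r, (0 : ℝ) < (min (n r) (m r) : ℕ) := fun r => by
      exact_mod_cast lt_min (hn r) (hm r)
    have hnm : ∀ r, (0 : ℝ) < n r * m r := fun r => by
      exact_mod_cast Nat.mul_pos (hn r) (hm r)
    have hinv : Tendsto (fun r => 1 / ((min (n r) (m r) : ℕ) : ℝ)) atTop (𝓝 0) := by
      simp only [one_div]
      exact tendsto_inv_atTop_zero.comp (tendsto_natCast_atTop_atTop.comp hmin)
    have hPen : Tendsto (fun r => TNPM.Pen 64 α₁ α₂ τ (n r) (m r) (G r).K (G r).L /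
        (n r * m r : ℝ)) atTop (𝓝 0) := by
      refine squeeze_zero (fun r => div_nonneg
        (TNPM.Pen_nonneg (by norm_num) hα₁ hα₂ hτ0 _ _ _ _) (hnm r).le)
        (fun r => TNPM.Pen_div_le (by norm_num) hα₁ hα₂ hτ0 (hn r) (hm r)
          ((G r).K_pos (hn r)) ((G r).L_pos (hm r))) ?_
      simpa using (hinv.add (hKL.const_mul 3)).const_mul
        (2 * τ * ((1 + 1 / α₂) * (64 * 3) + 1 / α₁) * 2)
    have hH2 := TNPM.H₂_nonneg (C := 64) (by norm_num) hα₁ hα₂ hα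
    have hint := fun r => (h r).integrable_and_integral_le (hn r) (hm r) hα₁ hα₂ hα (hτ r)
      (hmeas r) (hest r)
    have hmean : Tendsto (fun r => 1 / (n r * m r : ℝ) *
        ∫ ω, TNPM.frobSq (Phat r ω - TNPM.meanMatrix (G r) (Λ r) (Λ' r)) ∂(μ r))
        atTop (𝓝 0) := by
      refine squeeze_zero (g := fun r => TNPM.H₁ α₁ α₂ *
        (TNPM.Pen 64 α₁ α₂ τ (n r) (m r) (G r).K (G r).L / (n r * m r : ℝ)) +
          3 * TNPM.H₂ 64 α₁ α₂ * τ * (1 / ((min (n r) (m r) : ℕ) : ℝ))) (fun r => ?_)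
        (fun r => (hint r).2.trans ?_) ?_
      · exact mul_nonneg (one_div_pos.2 (hnm r)).le
          (integral_nonneg fun ω => TNPM.frobSq_nonneg _)
      · have h1 : 1 / (n r * m r : ℝ) ≤ 1 / ((min (n r) (m r) : ℕ) : ℝ) := by
          refine one_div_le_one_div_of_le (hw r) ?_
          exact_mod_cast (min_le_left (n r) (m r)).trans (Nat.le_mul_of_pos_right _ (hm r))
        have h2 : 3 * TNPM.H₂ 64 α₁ α₂ * TNPM.sigmaMaxSq (v r) * (1 / (n r * m r : ℝ)) ≤
            3 * TNPM.H₂ 64 α₁ α₂ * τ * (1 / ((min (n r) (m r) : ℕ) : ℝ)) := by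
          have := hτ r
          gcongr
        calc _ = TNPM.H₁ α₁ α₂ *
              (TNPM.Pen 64 α₁ α₂ τ (n r) (m r) (G r).K (G r).L / (n r * m r : ℝ)) +
              3 * TNPM.H₂ 64 α₁ α₂ * TNPM.sigmaMaxSq (v r) * (1 / (n r * m r : ℝ)) := by ring
          _ ≤ _ := by linarith
      · simpa using (hPen.const_mul (TNPM.H₁ α₁ α₂)).add
          (hinv.const_mul (3 * TNPM.H₂ 64 α₁ α₂ * τ))
    refine ⟨hPen, hmean, fun ε hε => ?_⟩
    have hlim := hmean.div_const ε
    rw [zero_div] at hlim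
    refine squeeze_zero (fun r => measureReal_nonneg) (fun r => ?_) hlim
    rw [le_div_iff₀ hε, mul_comm, ← integral_const_mul]
    exact mul_meas_ge_le_integral_of_nonneg
      (Eventually.of_forall fun ω =>
        mul_nonneg (one_div_pos.2 (hnm r)).le (TNPM.frobSq_nonneg _))
      ((hint r).1.const_mul _) ε
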